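/- Conventions. Manifolds are smooth, finite-dimensional, Hausdorff, second countable and without boundary. An almost Yamabe soliton $(M,g,\eta,\mu)$ is a Riemannian manifold $(M,g)$ with a smooth vector field $\eta$ (the potential field) and a smooth function $\mu:M\to\mathbb R$ such that $\tfrac12\,\mathcal L_\eta g=(\tau-\mu)\,g$, where $\tau$ is the scalar curvature of $g$. A Kaehler submersion $\pi:(M_1,g_1,J_1)\to(M_2,g_2,J_2)$ is a surjective Riemannian submersion from a Kaehler manifold onto an almost Hermitian manifold with $\pi_*\circ J_1=J_2\circ\pi_*$. A vector field $U$ on $M_1$ is vertical if $\pi_*U=0$; the fibres are totally geodesic if their second fundamental form vanishes, i.e. $\nabla_UV$ is vertical for all vertical fields $U,V$, where $\nabla$ is the Levi-Civita connection of $g_1$. Theorem. Let $\pi:(M_1,g_1,J_1)\to(M_2,g_2,J_2)$ be a Kaehler submersion whose total space is an almost Yamabe soliton $(M_1,g_1,\eta,\mu)$. Suppose that $\eta$ is vertical and that the fibres of $\pi$ are totally geodesic. Then for every $q\in M_2$ the fibre $F=\pi^{-1}(q)$, regarded as an embedded submanifold of dimension $\dim M_1-\dim M_2$ with the metric $\hat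 g$ induced by $g_1$, is an almost Yamabe soliton whose potential field is the restriction $\eta|_F$ (which is tangent to $F$). More precisely, if $\hat\tau$ is the scalar curvature of $(F,\hat g)$ and $\tau'$ that of $(M_2,g_2)$, then $$\tfrac12\,\mathcal L_{\eta|_F}\hat g=(\hat\tau-\hat\mu)\,\hat g,\qquad \hat\mu=\mu|_F-\tau'(q).$$ -/

import Mathlib

open Bundle Module Manifold
open scoped Manifold ContDiff

namespace AlmostYamabe

noncomputable section

section Riemannian

variable {E : Type*} [NormedAddCommGroup E] [NormedSpace ℝ E]
  {M : Type*} [TopologicalSpace M] [ChartedSpace E M] [IsManifold 𝓘(ℝ, E) ∞ M]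

/-- `X` is a smooth vector field on a manifold modelled on `E`. -/
def IsSmoothField (X : Π x : M, TangentSpace 𝓘(ℝ, E) x) : Prop :=
  ContMDiff 𝓘(ℝ, E) 𝓘(ℝ, E).tangent ∞ (fun x ↦ TotalSpace.mk' E x (X x))

variable (E M) in
/-- Smooth Riemannian metrics on `M`. -/
abbrev SmoothMetric : Type _ :=
  ContMDiffRiemannianMetric 𝓘(ℝ, E) ∞ E (fun x : M ↦ TangentSpace 𝓘(ℝ, E) x)

/-- The Lie derivative of the metric,
`(𝓛_η g)(X, Y) = η (g (X, Y)) - g ([η, X], Y) - g (X, [η, Y])`, evaluated at `x`. -/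
def lieDerivMetric (g : SmoothMetric E M) (η X Y : Π x : M, TangentSpace 𝓘(ℝ, E) x) (x : M) : ℝ :=
  mvfderiv 𝓘(ℝ, E) (fun y ↦ g.inner y (X y) (Y y)) x (η x)
    - g.inner x (VectorField.mlieBracket 𝓘(ℝ, E) η X x) (Y x)
    - g.inner x (X x) (VectorField.mlieBracket 𝓘(ℝ, E) η Y x)

/-- The right-hand side of the Koszul formula, i.e. the value of `g (∇_X Y, Z)` at `x`. -/
def koszul (g : SmoothMetric E M) (X Y Z : Π x : M, TangentSpace 𝓘(ℝ, E) x) (x : M) : ℝ :=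
  (1 / 2) *
    (mvfderiv 𝓘(ℝ, E) (fun y ↦ g.inner y (Y y) (Z y)) x (X x)
      + mvfderiv 𝓘(ℝ, E) (fun y ↦ g.inner y (X y) (Z y)) x (Y x)
      - mvfderiv 𝓘(ℝ, E) (fun y ↦ g.inner y (X y) (Y y)) x (Z x)
      + g.inner x (VectorField.mlieBracket 𝓘(ℝ, E) X Y x) (Z x)
      - g.inner x (VectorField.mlieBracket 𝓘(ℝ, E) X Z x) (Y x)
      - g.inner x (VectorField.mlieBracket 𝓘(ℝ, E) Y Z x) (X x))

variable [FiniteDimensional ℝ E]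

theorem exists_orthonormal (g : SmoothMetric E M) (x : M) :
    ∃ e : Fin (finrank ℝ E) → TangentSpace 𝓘(ℝ, E) x,
      ∀ i j, g.inner x (e i) (e j) = if i = j then 1 else 0 := by
  let _ : RiemannianBundle (fun x : M ↦ TangentSpace 𝓘(ℝ, E) x) := ⟨g.toRiemannianMetric⟩
  have : FiniteDimensional ℝ (TangentSpace 𝓘(ℝ, E) x) := inferInstanceAs (FiniteDimensional ℝ E)
  have hn : finrank ℝ (TangentSpace 𝓘(ℝ, E) x) = finrank ℝ E := rfl
  let b := (stdOrthonormalBasis ℝ (TangentSpace 𝓘(ℝ, E) x)).reindex (finCongr hn)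
  exact ⟨b, fun i j ↦ orthonormal_iff_ite.1 b.orthonormal i j⟩

/-- A (chosen) orthonormal basis of the tangent space at `x`. -/
def orthonormalFrame (g : SmoothMetric E M) (x : M) :
    Fin (finrank ℝ E) → TangentSpace 𝓘(ℝ, E) x :=
  (exists_orthonormal g x).choose

/-- The local extensions of the chosen orthonormal basis at `x` to vector fields which are smooth
near `x` (they have constant components in the trivialization of the tangent bundle at `x`). -/
def frameExtension (g : SmoothMetric E M) (x : M) (i : Fin (finrank ℝ E)) :
    Π y : M, TangentSpace 𝓘(ℝ, E) y :=
  FiberBundle.extend E (orthonormalFrame g x i)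

/-- The Levi-Civita connection: `leviCivita g X Y` is `∇_X Y`, the vector field determined by the
Koszul formula. As the Koszul expression is tensorial in its last argument, the vector
`∇_X Y` at `x` is obtained by expanding it in an orthonormal basis at `x`. -/
def leviCivita (g : SmoothMetric E M) (X Y : Π x : M, TangentSpace 𝓘(ℝ, E) x) (x : M) :
    TangentSpace 𝓘(ℝ, E) x :=
  ∑ i, koszul g X Y (frameExtension g x i) x • orthonormalFrame g x i

/-- The Riemann curvature `R(X, Y) Z = ∇_X ∇_Y Z - ∇_Y ∇_X Z - ∇_[X, Y] Z`. -/
def curvature (g : SmoothMetric E M) (X Y Z : Π x : M, TangentSpace 𝓘(ℝ, E) x) (x : M) :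
    TangentSpace 𝓘(ℝ, E) x :=
  leviCivita g X (leviCivita g Y Z) x - leviCivita g Y (leviCivita g X Z) x
    - leviCivita g (VectorField.mlieBracket 𝓘(ℝ, E) X Y) Z x

/-- The scalar curvature `τ = ∑ i j, g (R(e_i, e_j) e_j, e_i)` for an orthonormal basis `e`
(positive on round spheres). -/
def scalarCurvature (g : SmoothMetric E M) (x : M) : ℝ :=
  ∑ i, ∑ j, g.inner x
    (curvature g (frameExtension g x i) (frameExtension g x j) (frameExtension g x j) x)
    (orthonormalFrame g x i)

/-- `(M, g, η, μ)` is an almost Yamabe soliton: `η` is a smooth vector field, `μ` is a smooth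
function, and `(1/2) 𝓛_η g = (τ - μ) g`. -/
structure IsAlmostYamabeSoliton (g : SmoothMetric E M) (η : Π x : M, TangentSpace 𝓘(ℝ, E) x)
    (μ : M → ℝ) : Prop where
  smooth_field : IsSmoothField η
  smooth_function : ContMDiff 𝓘(ℝ, E) 𝓘(ℝ, ℝ) ∞ μ
  equation : ∀ X Y : Π x : M, TangentSpace 𝓘(ℝ, E) x, IsSmoothField X → IsSmoothField Y → ∀ x,
    (1 / 2) * lieDerivMetric g η X Y x = (scalarCurvature g x - μ x) * g.inner x (X x) (Y x)

/-- `(M, g, J)` is an almost Hermitian manifold. -/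
structure IsAlmostHermitian (g : SmoothMetric E M)
    (J : Π x : M, TangentSpace 𝓘(ℝ, E) x →L[ℝ] TangentSpace 𝓘(ℝ, E) x) : Prop where
  smooth : ContMDiff 𝓘(ℝ, E) (𝓘(ℝ, E).prod 𝓘(ℝ, E →L[ℝ] E)) ∞
    (fun x ↦ TotalSpace.mk' (E →L[ℝ] E)
      (E := fun x : M ↦ TangentSpace 𝓘(ℝ, E) x →L[ℝ] TangentSpace 𝓘(ℝ, E) x) x (J x))
  sq : ∀ x v, J x (J x v) = -v
  compatible : ∀ x v w, g.inner x (J x v) w + g.inner x v (J x w) = 0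

/-- `(M, g, J)` is a Kaehler manifold: almost Hermitian with `∇ J = 0`, that is,
`∇_X (J Y) = J (∇_X Y)`. -/
structure IsKaehler (g : SmoothMetric E M)
    (J : Π x : M, TangentSpace 𝓘(ℝ, E) x →L[ℝ] TangentSpace 𝓘(ℝ, E) x) : Prop
    extends IsAlmostHermitian g J where
  parallel : ∀ X Y : Π x : M, TangentSpace 𝓘(ℝ, E) x, IsSmoothField X → IsSmoothField Y → ∀ x,
    leviCivita g X (fun y ↦ J y (Y y)) x = J x (leviCivita g X Y x)

end Riemannian

section Submersion

variable {E₁ : Type*} [NormedAddCommGroup E₁] [NormedSpace ℝ E₁] [FiniteDimensional ℝ E₁]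
  {M₁ : Type*} [TopologicalSpace M₁] [ChartedSpace E₁ M₁] [IsManifold 𝓘(ℝ, E₁) ∞ M₁]
  {E₂ : Type*} [NormedAddCommGroup E₂] [NormedSpace ℝ E₂] [FiniteDimensional ℝ E₂]
  {M₂ : Type*} [TopologicalSpace M₂] [ChartedSpace E₂ M₂] [IsManifold 𝓘(ℝ, E₂) ∞ M₂]

variable (E₁ E₂) in
/-- A vector field on the total space is vertical if it is everywhere tangent to the fibres, i.e.
lies in the kernel of the differential of `φ`. -/
def IsVertical (φ : M₁ → M₂) (U : Π x : M₁, TangentSpace 𝓘(ℝ, E₁) x) : Prop :=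
  ∀ x, mfderiv 𝓘(ℝ, E₁) 𝓘(ℝ, E₂) φ x (U x) = 0

variable (E₂) in
/-- A tangent vector at `x` is horizontal if it is orthogonal to the kernel of the differential. -/
def IsHorizontalAt (g₁ : SmoothMetric E₁ M₁) (φ : M₁ → M₂) (x : M₁)
    (v : TangentSpace 𝓘(ℝ, E₁) x) : Prop :=
  ∀ u : TangentSpace 𝓘(ℝ, E₁) x, mfderiv 𝓘(ℝ, E₁) 𝓘(ℝ, E₂) φ x u = 0 → g₁.inner x v u = 0

/-- Riemannian submersions: smooth surjections of maximal rank whose differential is isometric on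
horizontal vectors. -/
structure IsRiemannianSubmersion (g₁ : SmoothMetric E₁ M₁) (g₂ : SmoothMetric E₂ M₂)
    (φ : M₁ → M₂) : Prop where
  smooth : ContMDiff 𝓘(ℝ, E₁) 𝓘(ℝ, E₂) ∞ φ
  surjective : Function.Surjective φ
  maximal_rank : ∀ x, Function.Surjective (mfderiv 𝓘(ℝ, E₁) 𝓘(ℝ, E₂) φ x)
  isometry : ∀ x (v w : TangentSpace 𝓘(ℝ, E₁) x),
    IsHorizontalAt E₂ g₁ φ x v → IsHorizontalAt E₂ g₁ φ x w →
    g₂.inner (φ x) (mfderiv 𝓘(ℝ, E₁) 𝓘(ℝ, E₂) φ x v) (mfderiv 𝓘(ℝ, E₁) 𝓘(ℝ, E₂) φ x w)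
      = g₁.inner x v w

/-- Kaehler submersions: Riemannian submersions between almost Hermitian manifolds which intertwine
the almost complex structures and whose total space is Kaehler. -/
structure IsKaehlerSubmersion
    (g₁ : SmoothMetric E₁ M₁)
    (J₁ : Π x : M₁, TangentSpace 𝓘(ℝ, E₁) x →L[ℝ] TangentSpace 𝓘(ℝ, E₁) x)
    (g₂ : SmoothMetric E₂ M₂)
    (J₂ : Π x : M₂, TangentSpace 𝓘(ℝ, E₂) x →L[ℝ] TangentSpace 𝓘(ℝ, E₂) x)
    (φ : M₁ → M₂) : Prop extends IsRiemannianSubmersion g₁ g₂ φ where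
  kaehler_total : IsKaehler g₁ J₁
  almostHermitian_base : IsAlmostHermitian g₂ J₂
  almostComplex_map : ∀ x (v : TangentSpace 𝓘(ℝ, E₁) x),
    mfderiv 𝓘(ℝ, E₁) 𝓘(ℝ, E₂) φ x (J₁ x v) = J₂ (φ x) (mfderiv 𝓘(ℝ, E₁) 𝓘(ℝ, E₂) φ x v)

variable (E₂) in
/-- The fibres are totally geodesic: their second fundamental form vanishes, i.e. the horizontal
part of `∇_U V` is zero for all vertical `U` and `V`. -/
def HasTotallyGeodesicFibres (g₁ : SmoothMetric E₁ M₁) (φ : M₁ → M₂) : Prop :=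
  ∀ U V : Π x : M₁, TangentSpace 𝓘(ℝ, E₁) x, IsSmoothField U → IsSmoothField V →
    IsVertical E₁ E₂ φ U → IsVertical E₁ E₂ φ V → IsVertical E₁ E₂ φ (leviCivita g₁ U V)

end Submersion

end

end AlmostYamabe

open Filter VectorField
open scoped Topology

set_option linter.unusedSectionVars false

namespace AlmostYamabe

/-! ### Smooth vector fields, functions and metrics -/

section Fields

variable {E : Type*} [NormedAddCommGroup E] [NormedSpace ℝ E]
  {M : Type*} [TopologicalSpace M] [ChartedSpace E M] [IsManifold 𝓘(ℝ, E) ∞ M]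
  {X Y Z : Π x : M, TangentSpace 𝓘(ℝ, E) x} {f : M → ℝ}

/-! Under the hypotheses both O'Neill tensors of the submersion vanish, so the total space is
locally a Riemannian product of fibre and base. Hence its scalar curvature at a point of the fibre
over `q` is the fibre's scalar curvature plus that of the base at `q`. On vectors tangent to the
fibre, `𝓛_η g₁` agrees with the Lie derivative of the induced metric along the restricted field.
Restricting the soliton equation to such vectors therefore gives the claim, the constant `τ'(q)`
being absorbed into the new function.

The tensor T vanishes because the fibres are totally geodesic. The tensor A vanishes by the Kaehler
condition: for horizontal lifts `X`, `Y` and vertical `V`, Koszul expresses both `g(∇_X Y, V)` and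
`g(∇_V X, Y)` through `g([X, Y], V)`. Since `∇J = 0`, this pairing satisfies two rules for moving
`J` between its arguments, and they contradict antisymmetry unless it is zero
(`IsLift.metric_mlieBracket_isVertical`). Consequently `∇` and the curvature of lifts are lifts of
those of the base, `∇_V X = 0`, and the mixed curvatures do not contribute to the scalar curvature
(`IsFibreImmersion.scalarCurvature_eq`).

Horizontal lifts and restrictions to a fibre are treated by the single notion `IsLift`: fields `X`,
`X'` that are related by `f` and satisfy `X = (df)* X'`. For these every term of the Koszul formula
on the source equals the corresponding term on the target (`IsLift.koszul_eq`). What remains in each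
case is to see that `∇` does not leave the class of lifts.

The preliminary parts derive from the Koszul definition of `leviCivita` the usual rules of a metric
torsion-free connection, the tensoriality of curvature, and the freedom to compute `scalarCurvature`
in any orthonormal frame of smooth fields (`scalarCurvature_eq_sum`). -/

theorem IsSmoothField.mdifferentiableAt (hX : IsSmoothField X) (x : M) :
    MDifferentiableAt 𝓘(ℝ, E) 𝓘(ℝ, E).tangent (fun x ↦ TotalSpace.mk' E x (X x)) x :=
  (hX x).mdifferentiableAt (by simp)

theorem IsSmoothField.add (hX : IsSmoothField X) (hY : IsSmoothField Y) :
    IsSmoothField (X + Y) :=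
  ContMDiff.add_section hX hY

theorem IsSmoothField.sub (hX : IsSmoothField X) (hY : IsSmoothField Y) :
    IsSmoothField (X - Y) :=
  ContMDiff.sub_section hX hY

theorem IsSmoothField.neg (hX : IsSmoothField X) : IsSmoothField (-X) :=
  ContMDiff.neg_section hX

theorem IsSmoothField.smul (hf : ContMDiff 𝓘(ℝ, E) 𝓘(ℝ, ℝ) ∞ f) (hX : IsSmoothField X) :
    IsSmoothField (f • X) :=
  ContMDiff.smul_section hf hX

theorem isSmoothField_zero : IsSmoothField (0 : Π x : M, TangentSpace 𝓘(ℝ, E) x) :=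
  contMDiff_zeroSection ℝ (TangentSpace 𝓘(ℝ, E))

theorem IsSmoothField.mlieBracket [CompleteSpace E] (hX : IsSmoothField X) (hY : IsSmoothField Y) :
    IsSmoothField (mlieBracket 𝓘(ℝ, E) X Y) :=
  haveI : IsManifold 𝓘(ℝ, E) (((⊤ : ℕ∞) : WithTop ℕ∞) + 1) M := by simpa
  haveI : IsManifold 𝓘(ℝ, E) (minSmoothness ℝ 2) M :=
    IsManifold.of_le (n := ∞)
      (by simp only [minSmoothness_of_isRCLikeNormedField]; exact WithTop.coe_le_coe.2 le_top)
  ContDiff.mlieBracket_vectorField (m := ⊤) (n := ⊤) hX hY (by simp)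

/-- The derivative is the fibre component of the tangent map of `f` composed with the section `X`.
-/
theorem contMDiff_mvfderiv_apply (hf : ContMDiff 𝓘(ℝ, E) 𝓘(ℝ, ℝ) ∞ f) (hX : IsSmoothField X) :
    ContMDiff 𝓘(ℝ, E) 𝓘(ℝ, ℝ) ∞ (fun x ↦ mvfderiv 𝓘(ℝ, E) f x (X x)) := by
  have h1 : ContMDiff 𝓘(ℝ, E).tangent 𝓘(ℝ, ℝ).tangent ∞ (tangentMap 𝓘(ℝ, E) 𝓘(ℝ, ℝ) f) :=
    hf.contMDiff_tangentMap (by simp)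
  have h2 := h1.comp hX
  intro x
  have h3 := h2 x
  rw [contMDiffAt_totalSpace] at h3
  refine h3.2.congr_of_eventuallyEq (Eventually.of_forall fun y ↦ ?_)
  simp [tangentMap]
  rfl

theorem contMDiff_metric_apply (g : SmoothMetric E M) (hX : IsSmoothField X)
    (hY : IsSmoothField Y) :
    ContMDiff 𝓘(ℝ, E) 𝓘(ℝ, ℝ) ∞ (fun x ↦ g.inner x (X x) (Y x)) := by
  let _ : RiemannianBundle (fun x : M ↦ TangentSpace 𝓘(ℝ, E) x) := ⟨g.toRiemannianMetric⟩
  exact ContMDiff.inner_bundle (F := E) (E := fun x : M ↦ TangentSpace 𝓘(ℝ, E) x) hX hY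

theorem mdifferentiableAt_metric_apply (g : SmoothMetric E M) {x : M}
    (hX : MDiffAt (T% X) x) (hY : MDiffAt (T% Y) x) :
    MDiffAt (fun x ↦ g.inner x (X x) (Y x)) x := by
  let _ : RiemannianBundle (fun x : M ↦ TangentSpace 𝓘(ℝ, E) x) := ⟨g.toRiemannianMetric⟩
  exact MDifferentiableAt.inner_bundle (F := E) (E := fun x : M ↦ TangentSpace 𝓘(ℝ, E) x) hX hY

end Fields

/-! ### Globalizing germs of functions and fields by cutoffs -/

section Bump

variable {E : Type*} [NormedAddCommGroup E] [NormedSpace ℝ E] [FiniteDimensional ℝ E]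
  {M : Type*} [TopologicalSpace M] [T2Space M] [ChartedSpace E M] [IsManifold 𝓘(ℝ, E) ∞ M]
  {X Y Z : Π x : M, TangentSpace 𝓘(ℝ, E) x} {f : M → ℝ}

theorem exists_smooth_cutoff {x : M} {s : Set M} (hs : s ∈ 𝓝 x) :
    ∃ ψ : M → ℝ, ContMDiff 𝓘(ℝ, E) 𝓘(ℝ, ℝ) ∞ ψ ∧ tsupport ψ ⊆ s ∧ ψ =ᶠ[𝓝 x] 1 := by
  obtain ⟨ψ, -, hψ⟩ := (SmoothBumpFunction.nhds_basis_tsupport (I := 𝓘(ℝ, E)) x).mem_iff.1 hs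
  exact ⟨ψ, ψ.contMDiff, hψ, ψ.eventuallyEq_one⟩

/-- Parallelism of `J`, total geodesy and the soliton equation are quantified over global smooth
fields, whereas frames and `frameExtension` are smooth only locally. A cutoff bridges the two
without changing the germ. -/
theorem exists_isSmoothField_eventuallyEq {x : M} {s : Set M} (hs : IsOpen s) (hx : x ∈ s)
    (hX : ContMDiffOn 𝓘(ℝ, E) 𝓘(ℝ, E).tangent ∞ (fun x ↦ TotalSpace.mk' E x (X x)) s) :
    ∃ X' : Π x : M, TangentSpace 𝓘(ℝ, E) x, IsSmoothField X' ∧ X' =ᶠ[𝓝 x] X := by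
  obtain ⟨ψ, hψ, hψs, hψ1⟩ := exists_smooth_cutoff (E := E) (hs.mem_nhds hx)
  refine ⟨ψ • X, ?_, ?_⟩
  · exact ContMDiffOn.smul_section_of_tsupport (u := s) (hψ.contMDiffOn) hs hψs hX
  · filter_upwards [hψ1] with y hy
    rw [Pi.smul_apply', hy]
    exact one_smul ℝ (X y)

theorem exists_smooth_eventuallyEq {x : M} {s : Set M} (hs : IsOpen s) (hx : x ∈ s)
    (hf : ContMDiffOn 𝓘(ℝ, E) 𝓘(ℝ, ℝ) ∞ f s) :
    ∃ f' : M → ℝ, ContMDiff 𝓘(ℝ, E) 𝓘(ℝ, ℝ) ∞ f' ∧ f' =ᶠ[𝓝 x] f := by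
  obtain ⟨ψ, hψ, hψs, hψ1⟩ := exists_smooth_cutoff (E := E) (hs.mem_nhds hx)
  refine ⟨ψ • f, ?_, ?_⟩
  · refine contMDiff_of_tsupport fun y hy ↦ ?_
    have : y ∈ s := hψs (tsupport_smul_subset_left _ _ hy)
    exact (hψ y).smul ((hf y this).contMDiffAt (hs.mem_nhds this))
  · filter_upwards [hψ1] with y hy
    simp [hy]

theorem exists_isSmoothField_eventuallyEq_extend (x : M) (v : TangentSpace 𝓘(ℝ, E) x) :
    ∃ X : Π x : M, TangentSpace 𝓘(ℝ, E) x, IsSmoothField X ∧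
      X =ᶠ[𝓝 x] FiberBundle.extend (E := fun x : M ↦ TangentSpace 𝓘(ℝ, E) x) E v := by
  let t := trivializationAt E (fun x : M ↦ TangentSpace 𝓘(ℝ, E) x) x
  refine exists_isSmoothField_eventuallyEq t.open_baseSet
    (FiberBundle.mem_baseSet_trivializationAt' x) ?_
  rw [t.contMDiffOn_section_baseSet_iff]
  refine (contMDiffOn_const (c := (t ⟨x, v⟩).2)).congr fun y hy ↦ ?_
  simp [FiberBundle.extend, t.apply_mk_symm hy, t]

theorem exists_isSmoothField_apply_eq (x : M) (v : TangentSpace 𝓘(ℝ, E) x) :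
    ∃ X : Π x : M, TangentSpace 𝓘(ℝ, E) x, IsSmoothField X ∧ X x = v := by
  obtain ⟨X, hX, h⟩ := exists_isSmoothField_eventuallyEq_extend x v
  exact ⟨X, hX, h.self_of_nhds.trans
    (FiberBundle.extend_apply_self (E := fun x : M ↦ TangentSpace 𝓘(ℝ, E) x) E v)⟩

/-- A smooth field vanishing at `x` is, near `x`, a combination of smooth fields whose
coefficients vanish at `x`. -/
theorem IsSmoothField.exists_eventuallyEq_sum (hX : IsSmoothField X) {x : M} (hx : X x = 0) :
    ∃ (f : Fin (finrank ℝ E) → M → ℝ) (W : Fin (finrank ℝ E) → Π x : M, TangentSpace 𝓘(ℝ, E) x),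
      (∀ i, ContMDiff 𝓘(ℝ, E) 𝓘(ℝ, ℝ) ∞ (f i)) ∧ (∀ i, f i x = 0) ∧
      (∀ i, IsSmoothField (W i)) ∧ X =ᶠ[𝓝 x] fun y ↦ ∑ i, f i y • W i y := by
  let t := trivializationAt E (fun x : M ↦ TangentSpace 𝓘(ℝ, E) x) x
  have hxt : x ∈ t.baseSet := FiberBundle.mem_baseSet_trivializationAt' x
  let b := finBasis ℝ E
  have hb : ∀ i, ∃ W : Π x : M, TangentSpace 𝓘(ℝ, E) x, IsSmoothField W ∧
      W =ᶠ[𝓝 x] t.localFrame b i := fun i ↦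
    exists_isSmoothField_eventuallyEq t.open_baseSet hxt (t.contMDiffOn_localFrame_baseSet ∞ b i)
  choose W hW hWb using hb
  have hc : ∀ i, ∃ f' : M → ℝ, ContMDiff 𝓘(ℝ, E) 𝓘(ℝ, ℝ) ∞ f' ∧
      f' =ᶠ[𝓝 x] fun y ↦ t.localFrameCoeff 𝓘(ℝ, E) b i y (X y) := fun i ↦
    exists_smooth_eventuallyEq t.open_baseSet hxt
      (contMDiffOn_baseSet_localFrameCoeff b hX.contMDiffOn i)
  choose c hc hcb using hc
  refine ⟨c, W, hc, fun i ↦ by simp [(hcb i).self_of_nhds, hx], hW, ?_⟩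
  filter_upwards [t.eventually_eq_localFrame_sum_coeff_smul (I := 𝓘(ℝ, E)) b hxt (s := X),
    eventually_all.2 hWb, eventually_all.2 hcb] with y hy h1 h2
  rw [hy]
  exact Finset.sum_congr rfl fun i _ ↦ by rw [h1, h2]

end Bump

/-! ### The Lie bracket as a commutator of derivations -/

section Bracket

variable {E : Type*} [NormedAddCommGroup E] [NormedSpace ℝ E]
  {M : Type*} [TopologicalSpace M] [ChartedSpace E M] [IsManifold 𝓘(ℝ, E) ∞ M]
  {X Y Z : Π x : M, TangentSpace 𝓘(ℝ, E) x} {f : M → ℝ}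

/-- The expression of a vector field in the preferred chart at `x`. -/
noncomputable def fieldInChart (x : M) (X : Π x : M, TangentSpace 𝓘(ℝ, E) x) : E → E :=
  mpullbackWithin 𝓘(ℝ, E) 𝓘(ℝ, E) (extChartAt 𝓘(ℝ, E) x).symm X (Set.range 𝓘(ℝ, E))

/-- Chain rule: `fieldInChart` applies the inverse of the derivative of the inverse chart, which
cancels against the derivative of the inverse chart inside `h ∘ chart⁻¹`. -/
theorem fderiv_comp_extChartAt_symm_fieldInChart {h : M → ℝ} {x y : M}
    (hy : y ∈ (extChartAt 𝓘(ℝ, E) x).source)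
    (hh : MDifferentiableAt 𝓘(ℝ, E) 𝓘(ℝ, ℝ) h y) (X : Π x : M, TangentSpace 𝓘(ℝ, E) x) :
    fderiv ℝ (h ∘ (extChartAt 𝓘(ℝ, E) x).symm) (extChartAt 𝓘(ℝ, E) x y)
      (fieldInChart x X (extChartAt 𝓘(ℝ, E) x y)) = mvfderiv 𝓘(ℝ, E) h y (X y) := by
  have hyt := (extChartAt 𝓘(ℝ, E) x).map_source hy
  have hyy := (extChartAt 𝓘(ℝ, E) x).left_inv hy
  have hs : MDifferentiableAt 𝓘(ℝ, E) 𝓘(ℝ, E) (extChartAt 𝓘(ℝ, E) x).symm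
      (extChartAt 𝓘(ℝ, E) x y) := by
    have := mdifferentiableWithinAt_extChartAt_symm (I := 𝓘(ℝ, E)) hyt
    rwa [ModelWithCorners.range_eq_univ, mdifferentiableWithinAt_univ] at this
  have hinv := isInvertible_mfderivWithin_extChartAt_symm (I := 𝓘(ℝ, E)) hyt
  have hchain := mvfderiv_comp_apply_of_eq (I := 𝓘(ℝ, E)) (I' := 𝓘(ℝ, E))
    (f := (extChartAt 𝓘(ℝ, E) x).symm) (g := h)
    (extChartAt 𝓘(ℝ, E) x y) hh hs hyy (fieldInChart (E := E) x X (extChartAt 𝓘(ℝ, E) x y))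
  have e1 : mvfderiv 𝓘(ℝ, E) (h ∘ (extChartAt 𝓘(ℝ, E) x).symm) (extChartAt 𝓘(ℝ, E) x y) =
      fderiv ℝ (h ∘ (extChartAt 𝓘(ℝ, E) x).symm) (extChartAt 𝓘(ℝ, E) x y) := by
    simp [mvfderiv]
    rfl
  have e2 := hinv.self_apply_inverse (X ((extChartAt 𝓘(ℝ, E) x).symm (extChartAt 𝓘(ℝ, E) x y)))
  have e3 : mfderivWithin 𝓘(ℝ, E) 𝓘(ℝ, E) (extChartAt 𝓘(ℝ, E) x).symm (Set.range 𝓘(ℝ, E))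
      (extChartAt 𝓘(ℝ, E) x y) = mfderiv 𝓘(ℝ, E) 𝓘(ℝ, E) (extChartAt 𝓘(ℝ, E) x).symm
      (extChartAt 𝓘(ℝ, E) x y) := by
    rw [ModelWithCorners.range_eq_univ, mfderivWithin_univ]
  refine (DFunLike.congr_fun e1 _).symm.trans (hchain.trans ?_)
  rw [← e3]
  refine (congrArg (mvfderiv 𝓘(ℝ, E) h y) e2).trans ?_
  rw [hyy]

/-- The manifold bracket at `x` is by definition the chart bracket transported back by the inverse
derivative of the chart at `x`; transporting it forward again cancels. -/
theorem fieldInChart_mlieBracket (X Y : Π x : M, TangentSpace 𝓘(ℝ, E) x) (x : M) :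
    fieldInChart x (mlieBracket 𝓘(ℝ, E) X Y) (extChartAt 𝓘(ℝ, E) x x) =
      lieBracket ℝ (fieldInChart x X) (fieldInChart x Y) (extChartAt 𝓘(ℝ, E) x x) := by
  set w : E := lieBracket ℝ (fieldInChart x X) (fieldInChart x Y) (extChartAt 𝓘(ℝ, E) x x) with hw
  have hbr : mlieBracket 𝓘(ℝ, E) X Y x =
      (mfderiv 𝓘(ℝ, E) 𝓘(ℝ, E) (extChartAt 𝓘(ℝ, E) x) x).inverse w := by
    let u : E := lieBracketWithin ℝ (fieldInChart x X) (fieldInChart x Y)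
      ((extChartAt 𝓘(ℝ, E) x).symm ⁻¹' Set.univ ∩ Set.range 𝓘(ℝ, E)) (extChartAt 𝓘(ℝ, E) x x)
    have h0 : mlieBracket 𝓘(ℝ, E) X Y x =
        (mfderiv 𝓘(ℝ, E) 𝓘(ℝ, E) (extChartAt 𝓘(ℝ, E) x) x).inverse u := by
      rw [← mlieBracketWithin_univ, mlieBracketWithin_apply]
      rfl
    refine h0.trans (congrArg (fun u : E ↦
      (mfderiv 𝓘(ℝ, E) 𝓘(ℝ, E) (extChartAt 𝓘(ℝ, E) x) x).inverse u) ?_)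
    simp only [u, hw]
    rw [Set.preimage_univ, Set.univ_inter, ModelWithCorners.range_eq_univ, lieBracketWithin_univ]
  have hA : (mfderivWithin 𝓘(ℝ, E) 𝓘(ℝ, E) (extChartAt 𝓘(ℝ, E) x).symm (Set.range 𝓘(ℝ, E))
      (extChartAt 𝓘(ℝ, E) x x)).inverse = mfderiv 𝓘(ℝ, E) 𝓘(ℝ, E) (extChartAt 𝓘(ℝ, E) x) x := by
    apply ContinuousLinearMap.inverse_eq
    · exact mfderivWithin_extChartAt_symm_comp_mfderiv_extChartAt' (mem_extChartAt_source x)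
    · exact mfderiv_extChartAt_comp_mfderivWithin_extChartAt_symm' (mem_extChartAt_source x)
  have hinv : (mfderiv 𝓘(ℝ, E) 𝓘(ℝ, E) (extChartAt 𝓘(ℝ, E) x) x).IsInvertible :=
    isInvertible_mfderiv_extChartAt (mem_extChartAt_source x)
  have hxx : (extChartAt 𝓘(ℝ, E) x).symm (extChartAt 𝓘(ℝ, E) x x) = x := by simp
  have hbase : (mlieBracket 𝓘(ℝ, E) X Y ((extChartAt 𝓘(ℝ, E) x).symm (extChartAt 𝓘(ℝ, E) x x)) : E) =
      mlieBracket 𝓘(ℝ, E) X Y x := by rw [hxx]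
  have h1 : fieldInChart x (mlieBracket 𝓘(ℝ, E) X Y) (extChartAt 𝓘(ℝ, E) x x) =
      mfderiv 𝓘(ℝ, E) 𝓘(ℝ, E) (extChartAt 𝓘(ℝ, E) x) x (mlieBracket 𝓘(ℝ, E) X Y x) :=
    (DFunLike.congr_fun hA _).trans
      (congrArg (fun u : E ↦ mfderiv 𝓘(ℝ, E) 𝓘(ℝ, E) (extChartAt 𝓘(ℝ, E) x) x u) hbase)
  rw [h1, hbr]
  exact hinv.self_apply_inverse w

variable [FiniteDimensional ℝ E]

theorem IsSmoothField.differentiableAt_fieldInChart (hX : IsSmoothField X) (x : M) :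
    DifferentiableAt ℝ (fieldInChart x X) (extChartAt 𝓘(ℝ, E) x x) := by
  have h : DifferentiableWithinAt ℝ (fieldInChart x X)
      ((extChartAt 𝓘(ℝ, E) x).symm ⁻¹' Set.univ ∩ Set.range 𝓘(ℝ, E)) (extChartAt 𝓘(ℝ, E) x x) :=
    (hX.mdifferentiableAt x).mdifferentiableWithinAt (s := Set.univ)
      |>.differentiableWithinAt_mpullbackWithin_vectorField
  rwa [Set.preimage_univ, Set.univ_inter, ModelWithCorners.range_eq_univ,
    differentiableWithinAt_univ] at h

/-- The Lie bracket acts on functions as a commutator of derivations. -/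
theorem mvfderiv_mlieBracket (hf : ContMDiff 𝓘(ℝ, E) 𝓘(ℝ, ℝ) ∞ f) (hX : IsSmoothField X)
    (hY : IsSmoothField Y) (x : M) :
    mvfderiv 𝓘(ℝ, E) f x (mlieBracket 𝓘(ℝ, E) X Y x) =
      mvfderiv 𝓘(ℝ, E) (fun y ↦ mvfderiv 𝓘(ℝ, E) f y (Y y)) x (X x) -
        mvfderiv 𝓘(ℝ, E) (fun y ↦ mvfderiv 𝓘(ℝ, E) f y (X y)) x (Y x) := by
  have hx := mem_extChartAt_source (I := 𝓘(ℝ, E)) x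
  have hxt := extChartAt_target_mem_nhds (I := 𝓘(ℝ, E)) x
  have hF : ContDiffAt ℝ ∞ (f ∘ (extChartAt 𝓘(ℝ, E) x).symm) (extChartAt 𝓘(ℝ, E) x x) :=
    ((hf _).comp _ ((contMDiffOn_extChartAt_symm x).contMDiffAt hxt)).contDiffAt
  have hd : ∀ {h : M → ℝ}, ContMDiff 𝓘(ℝ, E) 𝓘(ℝ, ℝ) ∞ h → ∀ y,
      MDifferentiableAt 𝓘(ℝ, E) 𝓘(ℝ, ℝ) h y := fun hh y ↦ (hh y).mdifferentiableAt (by simp)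
  have key : ∀ W : Π x : M, TangentSpace 𝓘(ℝ, E) x,
      (fun z ↦ fderiv ℝ (f ∘ (extChartAt 𝓘(ℝ, E) x).symm) z (fieldInChart x W z))
        =ᶠ[𝓝 (extChartAt 𝓘(ℝ, E) x x)]
        (fun y ↦ mvfderiv 𝓘(ℝ, E) f y (W y)) ∘ (extChartAt 𝓘(ℝ, E) x).symm := fun W ↦ by
    filter_upwards [hxt] with z hz
    have := fderiv_comp_extChartAt_symm_fieldInChart
      ((extChartAt 𝓘(ℝ, E) x).map_target hz) (hd hf _) W
    rwa [(extChartAt 𝓘(ℝ, E) x).right_inv hz] at this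
  -- In the chart this is the vector space identity, which rests on the symmetry of the second
  -- derivative of `f`.
  rw [← fderiv_comp_extChartAt_symm_fieldInChart hx (hd hf x), fieldInChart_mlieBracket,
    fderiv_apply_lieBracket hF
      (by simp only [minSmoothness_of_isRCLikeNormedField]; exact WithTop.coe_le_coe.2 le_top)
      (hY.differentiableAt_fieldInChart x) (hX.differentiableAt_fieldInChart x),
    (key X).fderiv_eq, (key Y).fderiv_eq]
  congr 1
  · exact fderiv_comp_extChartAt_symm_fieldInChart hx (hd (contMDiff_mvfderiv_apply hf hY) x) X
  · exact fderiv_comp_extChartAt_symm_fieldInChart hx (hd (contMDiff_mvfderiv_apply hf hX) x) Y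

end Bracket

/-! ### Brackets of related fields -/

section Related

variable {E : Type*} [NormedAddCommGroup E] [NormedSpace ℝ E] [FiniteDimensional ℝ E]
  {M : Type*} [TopologicalSpace M] [ChartedSpace E M] [IsManifold 𝓘(ℝ, E) ∞ M]
  {F : Type*} [NormedAddCommGroup F] [NormedSpace ℝ F] [FiniteDimensional ℝ F]
  {N : Type*} [TopologicalSpace N] [T2Space N] [ChartedSpace F N] [IsManifold 𝓘(ℝ, F) ∞ N]

/-- Linear functionals composed with a chart separate tangent vectors, and a cutoff makes them
global functions. -/
theorem eq_zero_of_forall_mvfderiv_eq_zero {y : N} {v : TangentSpace 𝓘(ℝ, F) y}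
    (hv : ∀ h : N → ℝ, ContMDiff 𝓘(ℝ, F) 𝓘(ℝ, ℝ) ∞ h → mvfderiv 𝓘(ℝ, F) h y v = 0) : v = 0 := by
  have hinv : (mfderiv 𝓘(ℝ, F) 𝓘(ℝ, F) (extChartAt 𝓘(ℝ, F) y) y).IsInvertible :=
    isInvertible_mfderiv_extChartAt (mem_extChartAt_source y)
  suffices h : mfderiv 𝓘(ℝ, F) 𝓘(ℝ, F) (extChartAt 𝓘(ℝ, F) y) y v = 0 by
    have := hinv.inverse_apply_self v
    rw [h, map_zero] at this
    exact this.symm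
  refine SeparatingDual.eq_zero_of_forall_dual_eq_zero (R := ℝ) (V := F) fun ℓ ↦ ?_
  obtain ⟨h, hh, hhy⟩ := exists_smooth_eventuallyEq (E := F) (f := ℓ ∘ extChartAt 𝓘(ℝ, F) y)
    (chartAt F y).open_source (mem_chart_source F y)
    (ℓ.contMDiff.comp_contMDiffOn contMDiffOn_extChartAt)
  have h1 := hv h hh
  have h2 : mvfderiv 𝓘(ℝ, F) h y = mvfderiv 𝓘(ℝ, F) (ℓ ∘ extChartAt 𝓘(ℝ, F) y) y :=
    hhy.mfderiv_eq
  rw [h2] at h1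
  have h3 := mvfderiv_comp_apply (I := 𝓘(ℝ, F)) (I' := 𝓘(ℝ, F)) (g := ℓ)
    (f := extChartAt 𝓘(ℝ, F) y) y ℓ.mdifferentiableAt
    (mdifferentiableAt_extChartAt (mem_chart_source F y)) v
  have h4 : mvfderiv 𝓘(ℝ, F) ℓ (extChartAt 𝓘(ℝ, F) y y) = ℓ := by
    simp [mvfderiv]
    rfl
  rw [h3, h4] at h1
  exact h1

/-- The Lie brackets of `φ`-related fields are `φ`-related. -/
theorem mfderiv_mlieBracket_of_related {φ : M → N} (hφ : ContMDiff 𝓘(ℝ, E) 𝓘(ℝ, F) ∞ φ)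
    {X Y : Π x : M, TangentSpace 𝓘(ℝ, E) x} {X' Y' : Π y : N, TangentSpace 𝓘(ℝ, F) y}
    (hX : IsSmoothField X) (hY : IsSmoothField Y) (hX' : IsSmoothField X') (hY' : IsSmoothField Y')
    (hXX' : ∀ x, mfderiv 𝓘(ℝ, E) 𝓘(ℝ, F) φ x (X x) = X' (φ x))
    (hYY' : ∀ x, mfderiv 𝓘(ℝ, E) 𝓘(ℝ, F) φ x (Y x) = Y' (φ x)) (x : M) :
    mfderiv 𝓘(ℝ, E) 𝓘(ℝ, F) φ x (mlieBracket 𝓘(ℝ, E) X Y x) =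
      mlieBracket 𝓘(ℝ, F) X' Y' (φ x) := by
  refine sub_eq_zero.1 (eq_zero_of_forall_mvfderiv_eq_zero fun h hh ↦ ?_)
  have hd : ∀ {h : N → ℝ}, ContMDiff 𝓘(ℝ, F) 𝓘(ℝ, ℝ) ∞ h → ∀ y v,
      mvfderiv 𝓘(ℝ, E) (fun y ↦ h (φ y)) y v =
        mvfderiv 𝓘(ℝ, F) h (φ y) (mfderiv 𝓘(ℝ, E) 𝓘(ℝ, F) φ y v) := fun hh y v ↦
    mvfderiv_comp_apply (I := 𝓘(ℝ, F)) (I' := 𝓘(ℝ, E)) y ((hh _).mdifferentiableAt (by simp))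
      ((hφ y).mdifferentiableAt (by simp)) v
  rw [map_sub, ← hd hh, mvfderiv_mlieBracket hh hX' hY',
    mvfderiv_mlieBracket (f := fun y ↦ h (φ y)) (hh.comp hφ) hX hY]
  simp only [hd hh, hXX', hYY', hd (contMDiff_mvfderiv_apply hh hX'),
    hd (contMDiff_mvfderiv_apply hh hY'), sub_self]

end Related

/-! ### Smoothness of fields tested by the metric -/

section Sharp

variable {E : Type*} [NormedAddCommGroup E] [NormedSpace ℝ E] [FiniteDimensional ℝ E]
  {M : Type*} [TopologicalSpace M] [T2Space M] [ChartedSpace E M] [IsManifold 𝓘(ℝ, E) ∞ M]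

theorem metric_ext (g : SmoothMetric E M) {x : M} {v w : TangentSpace 𝓘(ℝ, E) x}
    (h : ∀ u, g.inner x v u = g.inner x w u) : v = w := by
  by_contra hne
  have h1 := g.pos x (v - w) (sub_ne_zero.2 hne)
  have h2 := h (v - w)
  rw [map_sub (g.inner x), sub_apply, h2, sub_self] at h1
  exact lt_irrefl _ h1

/-- A vector field is smooth as soon as its inner products with smooth fields are smooth. -/
theorem isSmoothField_of_metric_apply (g : SmoothMetric E M) {Z : Π x : M, TangentSpace 𝓘(ℝ, E) x}
    (hZ : ∀ W : Π x : M, TangentSpace 𝓘(ℝ, E) x, IsSmoothField W →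
      ContMDiff 𝓘(ℝ, E) 𝓘(ℝ, ℝ) ∞ (fun x ↦ g.inner x (Z x) (W x))) : IsSmoothField Z := by
  intro x
  let t := trivializationAt E (fun x : M ↦ TangentSpace 𝓘(ℝ, E) x) x
  have hxt : x ∈ t.baseSet := FiberBundle.mem_baseSet_trivializationAt' x
  let b := finBasis ℝ E
  have hb : ∀ i, ∃ W : Π x : M, TangentSpace 𝓘(ℝ, E) x, IsSmoothField W ∧
      W =ᶠ[𝓝 x] t.localFrame b i := fun i ↦
    exists_isSmoothField_eventuallyEq t.open_baseSet hxt (t.contMDiffOn_localFrame_baseSet ∞ b i)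
  choose W hW hWb using hb
  let c : Fin (finrank ℝ E) → E →L[ℝ] ℝ := fun i ↦ LinearMap.toContinuousLinearMap (b.coord i)
  let G : M → E →L[ℝ] E →L[ℝ] ℝ := fun y ↦
    ∑ i, ∑ j, g.inner y (W i y) (W j y) • (c i).smulRight (c j)
  let ℓ : M → E →L[ℝ] ℝ := fun y ↦ ∑ j, g.inner y (Z y) (W j y) • c j
  have hG : ContMDiff 𝓘(ℝ, E) 𝓘(ℝ, E →L[ℝ] E →L[ℝ] ℝ) ∞ G :=
    contMDiff_finsetSum fun i _ ↦ contMDiff_finsetSum fun j _ ↦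
      (contMDiff_metric_apply g (hW i) (hW j)).smul contMDiff_const
  have hℓ : ContMDiff 𝓘(ℝ, E) 𝓘(ℝ, E →L[ℝ] ℝ) ∞ ℓ :=
    contMDiff_finsetSum fun j _ ↦ (hZ _ (hW j)).smul contMDiff_const
  -- the Gram operator in the frame `W` is invertible near `x`
  have key : ∀ᶠ y in 𝓝 x, (G y).IsInvertible ∧ G y (t ⟨y, Z y⟩).2 = ℓ y := by
    filter_upwards [t.open_baseSet.mem_nhds hxt, eventually_all.2 hWb] with y hy hWy
    let L := t.linearEquivAt ℝ y hy
    have hfr : ∀ i, W i y = L.symm (b i) := fun i ↦ by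
      rw [hWy, t.localFrame_apply_of_mem_baseSet b hy]
      simp [Trivialization.basisAt, L]
    have hsum : ∀ u : E, L.symm u = ∑ i, b.repr u i • W i y := fun u ↦ by
      conv_lhs => rw [← b.sum_repr u, map_sum]
      simp [hfr]
    have hGy : ∀ u w : E, G y u w = g.inner y (L.symm u) (L.symm w) := fun u w ↦ by
      rw [hsum u, hsum w]
      simp only [G, c, map_sum, map_smul, sum_apply, smul_apply, smul_eq_mul,
        ContinuousLinearMap.smulRight_apply, LinearMap.coe_toContinuousLinearMap', Basis.coord_apply,
        Finset.mul_sum]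
      refine Finset.sum_comm.trans (Finset.sum_congr rfl fun i _ ↦
        Finset.sum_congr rfl fun j _ ↦ by ring)
    have hℓy : ∀ w : E, ℓ y w = g.inner y (Z y) (L.symm w) := fun w ↦ by
      rw [hsum w]
      simp only [ℓ, c, map_sum, map_smul, sum_apply, smul_apply, smul_eq_mul,
        LinearMap.coe_toContinuousLinearMap', Basis.coord_apply]
      exact Finset.sum_congr rfl fun j _ ↦ by ring
    constructor
    · have hinj : Function.Injective (G y).toLinearMap := by
        rw [← LinearMap.ker_eq_bot, LinearMap.ker_eq_bot']
        intro u hu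
        have h0 : G y u = 0 := hu
        by_contra hne
        have h1 := g.pos y (L.symm u) (by simpa using hne)
        rw [← hGy, h0] at h1
        exact lt_irrefl _ h1
      have hfin : finrank ℝ E = finrank ℝ (E →L[ℝ] ℝ) := by
        rw [← (LinearMap.toContinuousLinearMap (𝕜 := ℝ) (E := E) (F' := ℝ)).finrank_eq]
        exact (Subspace.dual_finrank_eq (K := ℝ) (V := E)).symm
      exact ⟨(LinearEquiv.ofInjectiveOfFinrankEq (G y).toLinearMap hinj hfin).toContinuousLinearEquiv,
        by ext; rfl⟩
    · ext w
      rw [hGy, hℓy]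
      congr 2
      exact L.symm_apply_apply (Z y)
  -- The coordinates of `Z` are the Gram operator's inverse applied to `ℓ`, and inversion is smooth
  -- near an invertible operator. The default value of `inverse` elsewhere is harmless, since only
  -- the germ at `x` enters.
  have hz : ContMDiffAt 𝓘(ℝ, E) 𝓘(ℝ, E) ∞ (fun y ↦ (G y).inverse (ℓ y)) x := by
    obtain ⟨e, he⟩ := key.self_of_nhds.1
    have h1 : ContDiffAt ℝ ∞ ContinuousLinearMap.inverse (G x) := by
      rw [← he]
      exact contDiffAt_map_inverse e
    exact (h1.contMDiffAt.comp x (hG x)).clm_apply (hℓ x)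
  rw [Trivialization.contMDiffAt_section_iff t hxt]
  refine hz.congr_of_eventuallyEq ?_
  filter_upwards [key] with y hy
  rw [← hy.2]
  exact (hy.1.inverse_apply_self _).symm

end Sharp

/-! ### Algebra of the Koszul expression -/

section Koszul

variable {E : Type*} [NormedAddCommGroup E] [NormedSpace ℝ E] [FiniteDimensional ℝ E]
  {M : Type*} [TopologicalSpace M] [ChartedSpace E M] [IsManifold 𝓘(ℝ, E) ∞ M]
  {g : SmoothMetric E M} {X X' Y Y' Z Z' : Π x : M, TangentSpace 𝓘(ℝ, E) x} {f : M → ℝ} {x : M}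

theorem mvfderiv_metric_add_left (hX : MDiffAt (T% X) x) (hX' : MDiffAt (T% X') x)
    (hY : MDiffAt (T% Y) x) (v : TangentSpace 𝓘(ℝ, E) x) :
    mvfderiv 𝓘(ℝ, E) (fun y ↦ g.inner y ((X + X') y) (Y y)) x v =
      mvfderiv 𝓘(ℝ, E) (fun y ↦ g.inner y (X y) (Y y)) x v +
        mvfderiv 𝓘(ℝ, E) (fun y ↦ g.inner y (X' y) (Y y)) x v := by
  have h : (fun y ↦ g.inner y ((X + X') y) (Y y)) =
      (fun y ↦ g.inner y (X y) (Y y)) + fun y ↦ g.inner y (X' y) (Y y) := by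
    ext y
    simp
  rw [h, mvfderiv_add (mdifferentiableAt_metric_apply g hX hY)
    (mdifferentiableAt_metric_apply g hX' hY)]
  rfl

theorem mvfderiv_metric_smul_left (hf : MDiffAt f x) (hX : MDiffAt (T% X) x)
    (hY : MDiffAt (T% Y) x) (v : TangentSpace 𝓘(ℝ, E) x) :
    mvfderiv 𝓘(ℝ, E) (fun y ↦ g.inner y ((f • X) y) (Y y)) x v =
      f x * mvfderiv 𝓘(ℝ, E) (fun y ↦ g.inner y (X y) (Y y)) x v +
        mvfderiv 𝓘(ℝ, E) f x v * g.inner x (X x) (Y x) := by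
  have h : (fun y ↦ g.inner y ((f • X) y) (Y y)) = f * fun y ↦ g.inner y (X y) (Y y) := by
    ext y
    simp
  rw [h, mvfderiv_mul hf (mdifferentiableAt_metric_apply g hX hY)]
  simp [mul_comm]

theorem mvfderiv_metric_comm (X Y : Π x : M, TangentSpace 𝓘(ℝ, E) x) (x : M) :
    mvfderiv 𝓘(ℝ, E) (fun y ↦ g.inner y (X y) (Y y)) x =
      mvfderiv 𝓘(ℝ, E) (fun y ↦ g.inner y (Y y) (X y)) x := by
  congr 1
  ext y
  exact g.symm y _ _

theorem mvfderiv_metric_add_right (hX : MDiffAt (T% X) x) (hX' : MDiffAt (T% X') x)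
    (hY : MDiffAt (T% Y) x) (v : TangentSpace 𝓘(ℝ, E) x) :
    mvfderiv 𝓘(ℝ, E) (fun y ↦ g.inner y (Y y) ((X + X') y)) x v =
      mvfderiv 𝓘(ℝ, E) (fun y ↦ g.inner y (Y y) (X y)) x v +
        mvfderiv 𝓘(ℝ, E) (fun y ↦ g.inner y (Y y) (X' y)) x v := by
  simp only [mvfderiv_metric_comm Y]
  exact mvfderiv_metric_add_left hX hX' hY v

theorem mvfderiv_metric_smul_right (hf : MDiffAt f x) (hX : MDiffAt (T% X) x)
    (hY : MDiffAt (T% Y) x) (v : TangentSpace 𝓘(ℝ, E) x) :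
    mvfderiv 𝓘(ℝ, E) (fun y ↦ g.inner y (Y y) ((f • X) y)) x v =
      f x * mvfderiv 𝓘(ℝ, E) (fun y ↦ g.inner y (Y y) (X y)) x v +
        mvfderiv 𝓘(ℝ, E) f x v * g.inner x (Y x) (X x) := by
  simp only [mvfderiv_metric_comm Y, g.symm x (Y x)]
  exact mvfderiv_metric_smul_left hf hX hY v

theorem isManifold_minSmoothness : IsManifold 𝓘(ℝ, E) (minSmoothness ℝ 2) M :=
  IsManifold.of_le (n := ∞)
    (by simp only [minSmoothness_of_isRCLikeNormedField]; exact WithTop.coe_le_coe.2 le_top)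

theorem koszul_add_right (hX : MDiffAt (T% X) x) (hY : MDiffAt (T% Y) x) (hZ : MDiffAt (T% Z) x)
    (hZ' : MDiffAt (T% Z') x) :
    koszul g X Y (Z + Z') x = koszul g X Y Z x + koszul g X Y Z' x := by
  have := isManifold_minSmoothness (E := E) (M := M)
  simp only [koszul, mvfderiv_metric_add_right hZ hZ' hY, mvfderiv_metric_add_right hZ hZ' hX,
    mlieBracket_add_right hZ hZ']
  simp only [Pi.add_apply, map_add, add_apply]
  ring

/-- The terms `X(f) g(Y, Z)` and `Y(f) g(X, Z)` from differentiating the metric cancel against those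
from `[X, fZ]` and `[Y, fZ]`. -/
theorem koszul_smul_right (hf : MDiffAt f x) (hX : MDiffAt (T% X) x) (hY : MDiffAt (T% Y) x)
    (hZ : MDiffAt (T% Z) x) :
    koszul g X Y (f • Z) x = f x * koszul g X Y Z x := by
  have := isManifold_minSmoothness (E := E) (M := M)
  simp only [koszul, mvfderiv_metric_smul_right hf hZ hY, mvfderiv_metric_smul_right hf hZ hX,
    mlieBracket_smul_right hf hZ]
  simp only [Pi.smul_apply', map_add, add_apply, map_smul, smul_apply, smul_eq_mul]
  rw [g.symm x (Z x) (Y x), g.symm x (Z x) (X x)]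
  ring

theorem koszul_add_left (hX : MDiffAt (T% X) x) (hX' : MDiffAt (T% X') x) (hY : MDiffAt (T% Y) x)
    (hZ : MDiffAt (T% Z) x) :
    koszul g (X + X') Y Z x = koszul g X Y Z x + koszul g X' Y Z x := by
  have := isManifold_minSmoothness (E := E) (M := M)
  simp only [koszul, mvfderiv_metric_add_left hX hX' hY, mvfderiv_metric_add_left hX hX' hZ,
    mlieBracket_add_left hX hX']
  simp only [Pi.add_apply, map_add, add_apply]
  ring

theorem koszul_smul_left (hf : MDiffAt f x) (hX : MDiffAt (T% X) x) (hY : MDiffAt (T% Y) x)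
    (hZ : MDiffAt (T% Z) x) :
    koszul g (f • X) Y Z x = f x * koszul g X Y Z x := by
  have := isManifold_minSmoothness (E := E) (M := M)
  simp only [koszul, mvfderiv_metric_smul_left hf hX hY, mvfderiv_metric_smul_left hf hX hZ,
    mlieBracket_smul_left hf hX]
  simp only [Pi.smul_apply', map_add, add_apply, map_smul, smul_apply, smul_eq_mul, neg_smul,
    map_neg, neg_apply]
  ring

theorem koszul_add_middle (hX : MDiffAt (T% X) x) (hY : MDiffAt (T% Y) x)
    (hY' : MDiffAt (T% Y') x) (hZ : MDiffAt (T% Z) x) :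
    koszul g X (Y + Y') Z x = koszul g X Y Z x + koszul g X Y' Z x := by
  have := isManifold_minSmoothness (E := E) (M := M)
  simp only [koszul, mvfderiv_metric_add_left hY hY' hZ, mvfderiv_metric_add_right hY hY' hX,
    mlieBracket_add_left hY hY', mlieBracket_add_right hY hY']
  simp only [Pi.add_apply, map_add, add_apply]
  ring

/-- Here `X(f) g(Y, Z)` occurs twice, once from the metric and once from `[X, fY]`, which absorbs
the factor 1/2; the two terms in `Z(f)` cancel. This is the Leibniz rule for `∇`. -/
theorem koszul_smul_middle (hf : MDiffAt f x) (hX : MDiffAt (T% X) x) (hY : MDiffAt (T% Y) x)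
    (hZ : MDiffAt (T% Z) x) :
    koszul g X (f • Y) Z x =
      f x * koszul g X Y Z x + mvfderiv 𝓘(ℝ, E) f x (X x) * g.inner x (Y x) (Z x) := by
  have := isManifold_minSmoothness (E := E) (M := M)
  simp only [koszul, mvfderiv_metric_smul_left hf hY hZ, mvfderiv_metric_smul_right hf hY hX,
    mlieBracket_smul_left hf hY, mlieBracket_smul_right hf hY]
  simp only [Pi.smul_apply', map_add, add_apply, map_smul, smul_apply, smul_eq_mul, neg_smul,
    map_neg, neg_apply]
  rw [g.symm x (Y x) (X x)]
  ring

theorem koszul_congr (hX : X =ᶠ[𝓝 x] X') (hY : Y =ᶠ[𝓝 x] Y') (hZ : Z =ᶠ[𝓝 x] Z') :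
    koszul g X Y Z x = koszul g X' Y' Z' x := by
  have h : ∀ {U U' W W' : Π x : M, TangentSpace 𝓘(ℝ, E) x}, U =ᶠ[𝓝 x] U' → W =ᶠ[𝓝 x] W' →
      mvfderiv 𝓘(ℝ, E) (fun y ↦ g.inner y (U y) (W y)) x =
        mvfderiv 𝓘(ℝ, E) (fun y ↦ g.inner y (U' y) (W' y)) x := fun {U U' W W'} hU hW ↦ by
    refine EventuallyEq.mfderiv_eq ?_
    filter_upwards [hU, hW] with y h1 h2
    rw [h1, h2]
  simp only [koszul, h hX hY, h hY hZ, h hX hZ, hX.mlieBracket_vectorField_eq hY,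
    hX.mlieBracket_vectorField_eq hZ, hY.mlieBracket_vectorField_eq hZ, hX.self_of_nhds,
    hY.self_of_nhds, hZ.self_of_nhds]

theorem tensorialAt_koszul_right (hX : MDiffAt (T% X) x) (hY : MDiffAt (T% Y) x) :
    TensorialAt 𝓘(ℝ, E) E (fun Z : Π x : M, TangentSpace 𝓘(ℝ, E) x ↦ koszul g X Y Z x) x where
  smul hf hZ := koszul_smul_right hf hX hY hZ
  add hZ hZ' := koszul_add_right hX hY hZ hZ'

theorem tensorialAt_koszul_left (hY : MDiffAt (T% Y) x) (hZ : MDiffAt (T% Z) x) :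
    TensorialAt 𝓘(ℝ, E) E (fun X : Π x : M, TangentSpace 𝓘(ℝ, E) x ↦ koszul g X Y Z x) x where
  smul hf hX := koszul_smul_left hf hX hY hZ
  add hX hX' := koszul_add_left hX hX' hY hZ

end Koszul

/-! ### Orthonormal bases, traces, and the defining property of the connection -/

section Orthonormal

variable {E : Type*} [NormedAddCommGroup E] [NormedSpace ℝ E] [FiniteDimensional ℝ E]
  {M : Type*} [TopologicalSpace M] [ChartedSpace E M] [IsManifold 𝓘(ℝ, E) ∞ M]
  {g : SmoothMetric E M} {x : M}

theorem sum_metric_smul_eq {ι : Type*} [Fintype ι] [DecidableEq ι]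
    {e : ι → TangentSpace 𝓘(ℝ, E) x} (he : ∀ i j, g.inner x (e i) (e j) = if i = j then 1 else 0)
    (hcard : Fintype.card ι = finrank ℝ E) (v : TangentSpace 𝓘(ℝ, E) x) :
    ∑ i, g.inner x v (e i) • e i = v := by
  have hc : ∀ (c : ι → ℝ) j, g.inner x (∑ i, c i • e i) (e j) = c j := fun c j ↦ by
    simp [he]
  have hli : LinearIndependent ℝ e := Fintype.linearIndependent_iff.2 fun c h j ↦ by
    rw [← hc c j, h]
    simp
  have hfd : FiniteDimensional ℝ (TangentSpace 𝓘(ℝ, E) x) :=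
    inferInstanceAs (FiniteDimensional ℝ E)
  have hspan := hli.span_eq_top_of_card_eq_finrank' (hcard.trans rfl)
  obtain ⟨c, rfl⟩ := (Submodule.mem_span_range_iff_exists_fun ℝ).1
    (hspan ▸ Submodule.mem_top : v ∈ Submodule.span ℝ (Set.range e))
  simp only [hc]

/-- The trace of a bilinear form does not depend on the orthonormal basis, because the change of
basis matrix is orthogonal (`h2`). -/
theorem sum_bilin_eq_of_orthonormal {ι κ : Type*} [Fintype ι] [DecidableEq ι] [Fintype κ]
    [DecidableEq κ] {e : ι → TangentSpace 𝓘(ℝ, E) x} {e' : κ → TangentSpace 𝓘(ℝ, E) x}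
    (he : ∀ i j, g.inner x (e i) (e j) = if i = j then 1 else 0)
    (he' : ∀ i j, g.inner x (e' i) (e' j) = if i = j then 1 else 0)
    (hcard : Fintype.card ι = finrank ℝ E) (hcard' : Fintype.card κ = finrank ℝ E)
    (B : TangentSpace 𝓘(ℝ, E) x →ₗ[ℝ] TangentSpace 𝓘(ℝ, E) x →ₗ[ℝ] ℝ) :
    ∑ i, B (e i) (e i) = ∑ k, B (e' k) (e' k) := by
  have h1 : ∀ i, B (e i) (e i) =
      ∑ k, ∑ l, (g.inner x (e' k) (e i) * g.inner x (e' l) (e i)) * B (e' k) (e' l) := fun i ↦ by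
    conv_lhs => rw [← sum_metric_smul_eq he' hcard' (e i)]
    simp only [map_sum, map_smul, LinearMap.sum_apply, LinearMap.smul_apply, smul_eq_mul,
      Finset.mul_sum]
    rw [Finset.sum_comm]
    refine Finset.sum_congr rfl fun k _ ↦ Finset.sum_congr rfl fun l _ ↦ ?_
    rw [g.symm x (e i), g.symm x (e i)]
    ring
  have h2 : ∀ k l, ∑ i, g.inner x (e' k) (e i) * g.inner x (e' l) (e i) =
      if k = l then 1 else 0 := fun k l ↦ by
    rw [← he' k l]
    conv_rhs => rw [← sum_metric_smul_eq he hcard (e' l)]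
    simp only [map_sum, map_smul, smul_eq_mul]
    exact Finset.sum_congr rfl fun i _ ↦ mul_comm _ _
  simp only [h1]
  rw [Finset.sum_comm]
  refine Finset.sum_congr rfl fun k _ ↦ ?_
  rw [Finset.sum_comm]
  simp only [← Finset.sum_mul, h2]
  simp

theorem orthonormalFrame_orthonormal (g : SmoothMetric E M) (x : M)
    (i j : Fin (finrank ℝ E)) :
    g.inner x (orthonormalFrame g x i) (orthonormalFrame g x j) = if i = j then 1 else 0 :=
  (exists_orthonormal g x).choose_spec i j

variable {X X' Y Y' Z : Π x : M, TangentSpace 𝓘(ℝ, E) x}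

/-- The defining property of the Levi-Civita connection. -/
theorem metric_leviCivita (hX : MDiffAt (T% X) x) (hY : MDiffAt (T% Y) x)
    (hZ : MDiffAt (T% Z) x) : g.inner x (leviCivita g X Y x) (Z x) = koszul g X Y Z x := by
  have hT := tensorialAt_koszul_right (g := g) hX hY
  rw [← TensorialAt.mkHom_apply hT hZ]
  conv_rhs => rw [← sum_metric_smul_eq (orthonormalFrame_orthonormal g x) (by simp) (Z x)]
  simp only [leviCivita, map_sum, map_smul, sum_apply, smul_apply, smul_eq_mul]
  refine Finset.sum_congr rfl fun i _ ↦ ?_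
  rw [TensorialAt.mkHom_apply_eq_extend, g.symm x (Z x), mul_comm]
  rfl

theorem leviCivita_congr (hX : X =ᶠ[𝓝 x] X') (hY : Y =ᶠ[𝓝 x] Y') :
    leviCivita g X Y x = leviCivita g X' Y' x := by
  simp only [leviCivita]
  exact Finset.sum_congr rfl fun i _ ↦
    congrArg (· • _) (koszul_congr hX hY (EventuallyEq.refl _ _))

theorem leviCivita_eventuallyEq (hX : X =ᶠ[𝓝 x] X') (hY : Y =ᶠ[𝓝 x] Y') :
    leviCivita g X Y =ᶠ[𝓝 x] leviCivita g X' Y' := by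
  filter_upwards [hX.eventually_nhds, hY.eventually_nhds] with y h1 h2
  exact leviCivita_congr h1 h2

theorem curvature_congr {Z Z' : Π x : M, TangentSpace 𝓘(ℝ, E) x} (hX : X =ᶠ[𝓝 x] X')
    (hY : Y =ᶠ[𝓝 x] Y') (hZ : Z =ᶠ[𝓝 x] Z') :
    curvature g X Y Z x = curvature g X' Y' Z' x := by
  have h := hX.mlieBracket_vectorField hY
  simp only [curvature, leviCivita_congr hX (leviCivita_eventuallyEq hY hZ),
    leviCivita_congr hY (leviCivita_eventuallyEq hX hZ), leviCivita_congr h hZ]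

end Orthonormal

/-! ### The Levi-Civita connection: smoothness, Leibniz rule, torsion, compatibility -/

section Connection

variable {E : Type*} [NormedAddCommGroup E] [NormedSpace ℝ E] [FiniteDimensional ℝ E]
  {M : Type*} [TopologicalSpace M] [T2Space M] [ChartedSpace E M] [IsManifold 𝓘(ℝ, E) ∞ M]
  {g : SmoothMetric E M} {X X' Y Y' Z Z' : Π x : M, TangentSpace 𝓘(ℝ, E) x} {f : M → ℝ}

theorem metric_ext_of_fields (g : SmoothMetric E M) {x : M} {v w : TangentSpace 𝓘(ℝ, E) x}
    (h : ∀ W : Π x : M, TangentSpace 𝓘(ℝ, E) x, IsSmoothField W →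
      g.inner x v (W x) = g.inner x w (W x)) : v = w := by
  refine metric_ext g fun u ↦ ?_
  obtain ⟨W, hW, rfl⟩ := exists_isSmoothField_apply_eq x u
  exact h W hW

theorem contMDiff_koszul (hX : IsSmoothField X) (hY : IsSmoothField Y) (hZ : IsSmoothField Z) :
    ContMDiff 𝓘(ℝ, E) 𝓘(ℝ, ℝ) ∞ (koszul g X Y Z) := by
  have hD : ∀ {U V W : Π x : M, TangentSpace 𝓘(ℝ, E) x}, IsSmoothField U → IsSmoothField V →
      IsSmoothField W → ContMDiff 𝓘(ℝ, E) 𝓘(ℝ, ℝ) ∞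
        (fun x ↦ mvfderiv 𝓘(ℝ, E) (fun y ↦ g.inner y (V y) (W y)) x (U x)) :=
    fun hU hV hW ↦ contMDiff_mvfderiv_apply (contMDiff_metric_apply g hV hW) hU
  exact contMDiff_const.mul
    ((((((hD hX hY hZ).add (hD hY hX hZ)).sub (hD hZ hX hY)).add
      (contMDiff_metric_apply g (hX.mlieBracket hY) hZ)).sub
      (contMDiff_metric_apply g (hX.mlieBracket hZ) hY)).sub
      (contMDiff_metric_apply g (hY.mlieBracket hZ) hX))

theorem IsSmoothField.metric_leviCivita (hX : IsSmoothField X) (hY : IsSmoothField Y)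
    (hZ : IsSmoothField Z) (x : M) :
    g.inner x (leviCivita g X Y x) (Z x) = koszul g X Y Z x :=
  AlmostYamabe.metric_leviCivita (hX.mdifferentiableAt x) (hY.mdifferentiableAt x)
    (hZ.mdifferentiableAt x)

theorem IsSmoothField.leviCivita (hX : IsSmoothField X) (hY : IsSmoothField Y) :
    IsSmoothField (leviCivita g X Y) :=
  isSmoothField_of_metric_apply g fun W hW ↦ by
    simp only [hX.metric_leviCivita hY hW]
    exact contMDiff_koszul hX hY hW

theorem leviCivita_add_left (hX : IsSmoothField X) (hX' : IsSmoothField X')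
    (hY : IsSmoothField Y) : leviCivita g (X + X') Y = leviCivita g X Y + leviCivita g X' Y := by
  ext1 x
  refine metric_ext_of_fields g fun W hW ↦ ?_
  rw [(hX.add hX').metric_leviCivita hY hW, Pi.add_apply, map_add, add_apply,
    hX.metric_leviCivita hY hW, hX'.metric_leviCivita hY hW,
    koszul_add_left (hX.mdifferentiableAt x) (hX'.mdifferentiableAt x) (hY.mdifferentiableAt x)
      (hW.mdifferentiableAt x)]

theorem leviCivita_add_right (hX : IsSmoothField X) (hY : IsSmoothField Y)
    (hY' : IsSmoothField Y') : leviCivita g X (Y + Y') = leviCivita g X Y + leviCivita g X Y' := by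
  ext1 x
  refine metric_ext_of_fields g fun W hW ↦ ?_
  rw [hX.metric_leviCivita (hY.add hY') hW, Pi.add_apply, map_add, add_apply,
    hX.metric_leviCivita hY hW, hX.metric_leviCivita hY' hW,
    koszul_add_middle (hX.mdifferentiableAt x) (hY.mdifferentiableAt x) (hY'.mdifferentiableAt x)
      (hW.mdifferentiableAt x)]

theorem leviCivita_smul_left (hf : ContMDiff 𝓘(ℝ, E) 𝓘(ℝ, ℝ) ∞ f) (hX : IsSmoothField X)
    (hY : IsSmoothField Y) : leviCivita g (f • X) Y = f • leviCivita g X Y := by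
  ext1 x
  refine metric_ext_of_fields g fun W hW ↦ ?_
  rw [(hX.smul hf).metric_leviCivita hY hW, Pi.smul_apply', map_smul, smul_apply,
    hX.metric_leviCivita hY hW,
    koszul_smul_left ((hf x).mdifferentiableAt (by simp)) (hX.mdifferentiableAt x)
      (hY.mdifferentiableAt x) (hW.mdifferentiableAt x), smul_eq_mul]

theorem leviCivita_smul_right (hf : ContMDiff 𝓘(ℝ, E) 𝓘(ℝ, ℝ) ∞ f) (hX : IsSmoothField X)
    (hY : IsSmoothField Y) :
    leviCivita g X (f • Y) =
      f • leviCivita g X Y + (fun x ↦ mvfderiv 𝓘(ℝ, E) f x (X x)) • Y := by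
  ext1 x
  refine metric_ext_of_fields g fun W hW ↦ ?_
  rw [hX.metric_leviCivita (hY.smul hf) hW, Pi.add_apply, Pi.smul_apply', Pi.smul_apply',
    map_add, add_apply, map_smul, smul_apply, map_smul, smul_apply, hX.metric_leviCivita hY hW,
    koszul_smul_middle ((hf x).mdifferentiableAt (by simp)) (hX.mdifferentiableAt x)
      (hY.mdifferentiableAt x) (hW.mdifferentiableAt x), smul_eq_mul, smul_eq_mul]

theorem leviCivita_sub_swap (hX : IsSmoothField X) (hY : IsSmoothField Y) :
    leviCivita g X Y - leviCivita g Y X = mlieBracket 𝓘(ℝ, E) X Y := by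
  ext1 x
  refine metric_ext_of_fields g fun W hW ↦ ?_
  rw [Pi.sub_apply, map_sub, sub_apply, hX.metric_leviCivita hY hW, hY.metric_leviCivita hX hW]
  simp only [koszul, mvfderiv_metric_comm Y X x, mlieBracket_swap_apply (V := Y) (W := X), map_neg,
    neg_apply]
  ring

theorem mvfderiv_metric (hX : IsSmoothField X) (hY : IsSmoothField Y) (hZ : IsSmoothField Z)
    (x : M) :
    mvfderiv 𝓘(ℝ, E) (fun y ↦ g.inner y (Y y) (Z y)) x (X x) =
      g.inner x (leviCivita g X Y x) (Z x) + g.inner x (Y x) (leviCivita g X Z x) := by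
  rw [g.symm x (Y x), hX.metric_leviCivita hY hZ, hX.metric_leviCivita hZ hY]
  simp only [koszul, mvfderiv_metric_comm Z Y x, mlieBracket_swap_apply (V := Z) (W := Y), map_neg,
    neg_apply]
  ring

theorem leviCivita_apply_eq_of_left {x : M} (hX : IsSmoothField X) (hX' : IsSmoothField X')
    (hY : IsSmoothField Y) (h : X x = X' x) : leviCivita g X Y x = leviCivita g X' Y x := by
  refine metric_ext_of_fields g fun W hW ↦ ?_
  rw [hX.metric_leviCivita hY hW, hX'.metric_leviCivita hY hW]
  exact (tensorialAt_koszul_left (hY.mdifferentiableAt x) (hW.mdifferentiableAt x)).pointwise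
    (hX.mdifferentiableAt x) (hX'.mdifferentiableAt x) h

end Connection

/-! ### Pointwise dependence of tensorial operations -/

section Tensorial

variable {E : Type*} [NormedAddCommGroup E] [NormedSpace ℝ E] [FiniteDimensional ℝ E]
  {M : Type*} [TopologicalSpace M] [T2Space M] [ChartedSpace E M] [IsManifold 𝓘(ℝ, E) ∞ M]
  {g : SmoothMetric E M} {X X' Y Y' Z Z' : Π x : M, TangentSpace 𝓘(ℝ, E) x} {f : M → ℝ}
  {A : Type*} [AddCommGroup A] [Module ℝ A]

/-- An operation on smooth vector fields which is local and linear over smooth functions at `x`. -/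
structure IsTensorialAt (Φ : (Π x : M, TangentSpace 𝓘(ℝ, E) x) → A) (x : M) : Prop where
  add : ∀ {X Y : Π x : M, TangentSpace 𝓘(ℝ, E) x}, IsSmoothField X → IsSmoothField Y → Φ (X + Y) = Φ X + Φ Y
  smul : ∀ {f : M → ℝ} {X : Π x : M, TangentSpace 𝓘(ℝ, E) x},
    ContMDiff 𝓘(ℝ, E) 𝓘(ℝ, ℝ) ∞ f → IsSmoothField X → Φ (f • X) = f x • Φ X
  congr : ∀ {X Y : Π x : M, TangentSpace 𝓘(ℝ, E) x}, X =ᶠ[𝓝 x] Y → Φ X = Φ Y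

variable {Φ : (Π x : M, TangentSpace 𝓘(ℝ, E) x) → A} {x : M}

theorem IsTensorialAt.sum_smul (hΦ : IsTensorialAt Φ x) {ι : Type*} (s : Finset ι) {f : ι → M → ℝ}
    {W : ι → Π x : M, TangentSpace 𝓘(ℝ, E) x}
    (hf : ∀ i, ContMDiff 𝓘(ℝ, E) 𝓘(ℝ, ℝ) ∞ (f i)) (hW : ∀ i, IsSmoothField (W i)) :
    IsSmoothField (∑ i ∈ s, f i • W i) ∧ Φ (∑ i ∈ s, f i • W i) = ∑ i ∈ s, f i x • Φ (W i) := by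
  classical
  induction s using Finset.induction_on with
  | empty =>
    refine ⟨isSmoothField_zero, ?_⟩
    have := hΦ.smul (f := fun _ ↦ (0 : ℝ)) contMDiff_const (isSmoothField_zero (E := E) (M := M))
    simp only [Finset.sum_empty, zero_smul] at this ⊢
    rw [← this]
    congr 1
    ext y
    simp
  | insert i s hi ih =>
    rw [Finset.sum_insert hi, Finset.sum_insert hi]
    refine ⟨((hW i).smul (hf i)).add ih.1, ?_⟩
    rw [hΦ.add ((hW i).smul (hf i)) ih.1, hΦ.smul (hf i) (hW i), ih.2]

/-- Locality allows `X` to be replaced by its local expansion in smooth fields with coefficients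
vanishing at `x`; linearity over functions then kills each term. -/
theorem IsTensorialAt.eq_zero (hΦ : IsTensorialAt Φ x) (hX : IsSmoothField X) (h : X x = 0) :
    Φ X = 0 := by
  obtain ⟨f, W, hf, hf0, hW, hXs⟩ := hX.exists_eventuallyEq_sum h
  have h1 : X =ᶠ[𝓝 x] (∑ i, f i • W i : Π x : M, TangentSpace 𝓘(ℝ, E) x) := by
    filter_upwards [hXs] with y hy
    exact hy.trans (Finset.sum_apply y Finset.univ (fun i ↦ f i • W i)).symm
  refine (hΦ.congr h1).trans ((hΦ.sum_smul Finset.univ hf hW).2.trans ?_)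
  simp [hf0]

theorem IsTensorialAt.neg (hΦ : IsTensorialAt Φ x) (hX : IsSmoothField X) : Φ (-X) = -Φ X := by
  have h := hΦ.smul (f := fun _ ↦ (-1 : ℝ)) contMDiff_const hX
  rw [neg_one_smul] at h
  rw [← h]
  congr 1
  ext y
  simp

theorem IsTensorialAt.eq_of_apply_eq (hΦ : IsTensorialAt Φ x) (hX : IsSmoothField X)
    (hY : IsSmoothField Y) (h : X x = Y x) : Φ X = Φ Y := by
  have h1 := hΦ.eq_zero (hX.add hY.neg) (by simp [h])
  rw [hΦ.add hX hY.neg, hΦ.neg hY] at h1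
  exact add_neg_eq_zero.1 h1

/-- Since `Ψ` depends only on values at `x`, arbitrary smooth extensions `W v` turn it into a
bilinear form on the tangent space, whose trace is basis independent. -/
theorem sum_eq_of_isTensorialAt {ι κ : Type*} [Fintype ι] [DecidableEq ι] [Fintype κ]
    [DecidableEq κ] {Ψ : (Π x : M, TangentSpace 𝓘(ℝ, E) x) → (Π x : M, TangentSpace 𝓘(ℝ, E) x) → ℝ}
    (hΨ : ∀ Y, IsSmoothField Y → IsTensorialAt (fun X ↦ Ψ X Y) x)
    (hΨ' : ∀ X, IsSmoothField X → IsTensorialAt (fun Y ↦ Ψ X Y) x)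
    {e : ι → Π x : M, TangentSpace 𝓘(ℝ, E) x} {e' : κ → Π x : M, TangentSpace 𝓘(ℝ, E) x}
    (hes : ∀ i, IsSmoothField (e i)) (hes' : ∀ i, IsSmoothField (e' i))
    (he : ∀ i j, g.inner x (e i x) (e j x) = if i = j then 1 else 0)
    (he' : ∀ i j, g.inner x (e' i x) (e' j x) = if i = j then 1 else 0)
    (hcard : Fintype.card ι = finrank ℝ E) (hcard' : Fintype.card κ = finrank ℝ E) :
    ∑ i, Ψ (e i) (e i) = ∑ k, Ψ (e' k) (e' k) := by
  choose W hW hWx using fun v : TangentSpace 𝓘(ℝ, E) x ↦ exists_isSmoothField_apply_eq x v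
  let B : TangentSpace 𝓘(ℝ, E) x →ₗ[ℝ] TangentSpace 𝓘(ℝ, E) x →ₗ[ℝ] ℝ :=
    LinearMap.mk₂ ℝ (fun v w ↦ Ψ (W v) (W w))
      (fun u v w ↦ by
        rw [← (hΨ _ (hW w)).add (hW u) (hW v)]
        exact (hΨ _ (hW w)).eq_of_apply_eq (hW _) ((hW _).add (hW _)) (by simp [hWx]))
      (fun c v w ↦ by
        have hc : ContMDiff 𝓘(ℝ, E) 𝓘(ℝ, ℝ) ∞ (fun _ : M ↦ c) := contMDiff_const
        rw [← (hΨ _ (hW w)).smul hc (hW v)]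
        exact (hΨ _ (hW w)).eq_of_apply_eq (hW _) ((hW _).smul hc) (by simp [hWx]))
      (fun w u v ↦ by
        rw [← (hΨ' _ (hW w)).add (hW u) (hW v)]
        exact (hΨ' _ (hW w)).eq_of_apply_eq (hW _) ((hW _).add (hW _)) (by simp [hWx]))
      (fun c w v ↦ by
        have hc : ContMDiff 𝓘(ℝ, E) 𝓘(ℝ, ℝ) ∞ (fun _ : M ↦ c) := contMDiff_const
        rw [← (hΨ' _ (hW w)).smul hc (hW v)]
        exact (hΨ' _ (hW w)).eq_of_apply_eq (hW _) ((hW _).smul hc) (by simp [hWx]))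
  have hB : ∀ X Y : Π x : M, TangentSpace 𝓘(ℝ, E) x, IsSmoothField X → IsSmoothField Y →
      Ψ X Y = B (X x) (Y x) := fun X Y hX hY ↦
    ((hΨ _ hY).eq_of_apply_eq hX (hW _) (hWx _).symm).trans
      ((hΨ' _ (hW _)).eq_of_apply_eq hY (hW _) (hWx _).symm)
  simp only [hB _ _ (hes _) (hes _), hB _ _ (hes' _) (hes' _)]
  exact sum_bilin_eq_of_orthonormal he he' hcard hcard' B

end Tensorial

/-! ### Tensoriality of curvature and frame independence of the scalar curvature -/

section Curvature

variable {E : Type*} [NormedAddCommGroup E] [NormedSpace ℝ E] [FiniteDimensional ℝ E]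
  {M : Type*} [TopologicalSpace M] [T2Space M] [ChartedSpace E M] [IsManifold 𝓘(ℝ, E) ∞ M]
  {g : SmoothMetric E M} {X X' Y Y' Z Z' : Π x : M, TangentSpace 𝓘(ℝ, E) x} {f : M → ℝ}

theorem isTensorialAt_metric_left (g : SmoothMetric E M) (x : M) (v : TangentSpace 𝓘(ℝ, E) x) :
    IsTensorialAt (fun X : Π x : M, TangentSpace 𝓘(ℝ, E) x ↦ g.inner x v (X x)) x where
  add _ _ := by simp
  smul _ _ := by simp
  congr h := by simp only [h.self_of_nhds]

theorem IsTensorialAt.metric {x : M}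
    {Φ : (Π x : M, TangentSpace 𝓘(ℝ, E) x) → TangentSpace 𝓘(ℝ, E) x} (hΦ : IsTensorialAt Φ x)
    (g : SmoothMetric E M) (v : TangentSpace 𝓘(ℝ, E) x) :
    IsTensorialAt (fun X ↦ g.inner x (Φ X) v) x where
  add hX hY := by simp [hΦ.add hX hY]
  smul hf hX := by simp [hΦ.smul hf hX]
  congr h := by simp only [hΦ.congr h]

theorem curvature_swap (hX : IsSmoothField X) (hY : IsSmoothField Y) (hZ : IsSmoothField Z)
    (x : M) : curvature g X Y Z x = -curvature g Y X Z x := by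
  have h : mlieBracket 𝓘(ℝ, E) X Y = (fun _ : M ↦ (-1 : ℝ)) • mlieBracket 𝓘(ℝ, E) Y X := by
    ext1 y
    rw [mlieBracket_swap_apply]
    simp
  simp only [curvature, h, leviCivita_smul_left contMDiff_const (hY.mlieBracket hX) hZ]
  simp only [Pi.smul_apply', neg_smul, one_smul]
  abel

/-- The term `Y(f) ∇_X Z` coming from `∇_Y (f ∇_X Z)` is compensated by `[fX, Y] = f [X, Y] - Y(f)
X`. -/
theorem isTensorialAt_curvature_left (hY : IsSmoothField Y) (hZ : IsSmoothField Z) (x : M) :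
    IsTensorialAt (fun X ↦ curvature g X Y Z x) x where
  add {X X'} hX hX' := by
    have := isManifold_minSmoothness (E := E) (M := M)
    have h : mlieBracket 𝓘(ℝ, E) (X + X') Y = mlieBracket 𝓘(ℝ, E) X Y + mlieBracket 𝓘(ℝ, E) X' Y := by
      ext1 y
      exact mlieBracket_add_left (hX.mdifferentiableAt y) (hX'.mdifferentiableAt y)
    simp only [curvature, h, leviCivita_add_left hX hX' (hY.leviCivita hZ),
      leviCivita_add_left hX hX' hZ, leviCivita_add_right hY (hX.leviCivita hZ) (hX'.leviCivita hZ),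
      leviCivita_add_left (hX.mlieBracket hY) (hX'.mlieBracket hY) hZ, Pi.add_apply]
    abel
  smul {f X} hf hX := by
    have := isManifold_minSmoothness (E := E) (M := M)
    have hf' : ContMDiff 𝓘(ℝ, E) 𝓘(ℝ, ℝ) ∞ (fun x ↦ mvfderiv 𝓘(ℝ, E) f x (Y x)) :=
      contMDiff_mvfderiv_apply hf hY
    have h : mlieBracket 𝓘(ℝ, E) (f • X) Y =
        f • mlieBracket 𝓘(ℝ, E) X Y - (fun x ↦ mvfderiv 𝓘(ℝ, E) f x (Y x)) • X := by
      ext1 y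
      refine (mlieBracket_smul_left ((hf y).mdifferentiableAt (by simp))
        (hX.mdifferentiableAt y)).trans ?_
      simp only [Pi.sub_apply, Pi.smul_apply', neg_smul]
      abel
    have h' : leviCivita g (f • mlieBracket 𝓘(ℝ, E) X Y -
        (fun x ↦ mvfderiv 𝓘(ℝ, E) f x (Y x)) • X) Z =
        f • leviCivita g (mlieBracket 𝓘(ℝ, E) X Y) Z -
          (fun x ↦ mvfderiv 𝓘(ℝ, E) f x (Y x)) • leviCivita g X Z := by
      rw [← leviCivita_smul_left hf (hX.mlieBracket hY) hZ, ← leviCivita_smul_left hf' hX hZ,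
        eq_sub_iff_add_eq, ← leviCivita_add_left (((hX.mlieBracket hY).smul hf).sub (hX.smul hf'))
          (hX.smul hf') hZ, sub_add_cancel]
    simp only [curvature, h, h', leviCivita_smul_left hf hX (hY.leviCivita hZ),
      leviCivita_smul_left hf hX hZ, leviCivita_smul_right hf hY (hX.leviCivita hZ), Pi.add_apply,
      Pi.sub_apply, Pi.smul_apply', smul_sub]
    abel
  congr h := curvature_congr h (EventuallyEq.refl _ _) (EventuallyEq.refl _ _)

theorem isTensorialAt_curvature_middle (hX : IsSmoothField X) (hZ : IsSmoothField Z) (x : M) :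
    IsTensorialAt (fun Y ↦ curvature g X Y Z x) x where
  add {Y Y'} hY hY' := by
    simp only [curvature_swap hX hY hZ, curvature_swap hX hY' hZ, curvature_swap hX (hY.add hY') hZ,
      (isTensorialAt_curvature_left hX hZ x).add hY hY', neg_add]
  smul {f Y} hf hY := by
    simp only [curvature_swap hX hY hZ, curvature_swap hX (hY.smul hf) hZ,
      (isTensorialAt_curvature_left hX hZ x).smul hf hY, smul_neg]
  congr h := curvature_congr (EventuallyEq.refl _ _) h (EventuallyEq.refl _ _)

/-- First derivatives of `f` cancel in pairs; the second derivatives combine to `X(Y f) - Y(X f) -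
[X, Y] f`, which is zero by `mvfderiv_mlieBracket`. -/
theorem isTensorialAt_curvature_right (hX : IsSmoothField X) (hY : IsSmoothField Y) (x : M) :
    IsTensorialAt (fun Z ↦ curvature g X Y Z x) x where
  add {Z Z'} hZ hZ' := by
    simp only [curvature, leviCivita_add_right hX hZ hZ', leviCivita_add_right hY hZ hZ',
      leviCivita_add_right hX (hY.leviCivita hZ) (hY.leviCivita hZ'),
      leviCivita_add_right hY (hX.leviCivita hZ) (hX.leviCivita hZ'),
      leviCivita_add_right (hX.mlieBracket hY) hZ hZ', Pi.add_apply]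
    abel
  smul {f Z} hf hZ := by
    have hfX : ContMDiff 𝓘(ℝ, E) 𝓘(ℝ, ℝ) ∞ (fun x ↦ mvfderiv 𝓘(ℝ, E) f x (X x)) :=
      contMDiff_mvfderiv_apply hf hX
    have hfY : ContMDiff 𝓘(ℝ, E) 𝓘(ℝ, ℝ) ∞ (fun x ↦ mvfderiv 𝓘(ℝ, E) f x (Y x)) :=
      contMDiff_mvfderiv_apply hf hY
    simp only [curvature, leviCivita_smul_right hf hX hZ, leviCivita_smul_right hf hY hZ,
      leviCivita_add_right hX ((hY.leviCivita hZ).smul hf) (hZ.smul hfY),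
      leviCivita_add_right hY ((hX.leviCivita hZ).smul hf) (hZ.smul hfX),
      leviCivita_smul_right hf hX (hY.leviCivita hZ),
      leviCivita_smul_right hf hY (hX.leviCivita hZ),
      leviCivita_smul_right hfX hY hZ, leviCivita_smul_right hfY hX hZ,
      leviCivita_smul_right hf (hX.mlieBracket hY) hZ, Pi.add_apply, Pi.smul_apply', smul_sub,
      mvfderiv_mlieBracket hf hX hY x, sub_smul]
    abel
  congr h := curvature_congr (EventuallyEq.refl _ _) (EventuallyEq.refl _ _) h

theorem scalarCurvature_eq_sum {ι : Type*} [Fintype ι] [DecidableEq ι] {x : M}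
    {e : ι → Π x : M, TangentSpace 𝓘(ℝ, E) x} (hes : ∀ i, IsSmoothField (e i))
    (he : ∀ i j, g.inner x (e i x) (e j x) = if i = j then 1 else 0)
    (hcard : Fintype.card ι = finrank ℝ E) :
    scalarCurvature g x = ∑ i, ∑ j, g.inner x (curvature g (e i) (e j) (e j) x) (e i x) := by
  choose W hW hWx using fun i ↦ exists_isSmoothField_eventuallyEq_extend x (orthonormalFrame g x i)
  have hWv : ∀ i, W i x = orthonormalFrame g x i := fun i ↦ by
    rw [(hWx i).self_of_nhds]
    exact FiberBundle.extend_apply_self (F := E) (E := fun x : M ↦ TangentSpace 𝓘(ℝ, E) x)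
      (orthonormalFrame g x i)
  have h1 : scalarCurvature g x =
      ∑ i, ∑ j, g.inner x (curvature g (W i) (W j) (W j) x) (W i x) := by
    simp only [hWv]
    refine Finset.sum_congr rfl fun i _ ↦ Finset.sum_congr rfl fun j _ ↦ ?_
    rw [curvature_congr (hWx i) (hWx j) (hWx j)]
    rfl
  have hWo : ∀ i j, g.inner x (W i x) (W j x) = if i = j then 1 else 0 := fun i j ↦ by
    rw [hWv, hWv, orthonormalFrame_orthonormal]
  -- The scalar curvature is a double trace; the frame is exchanged in one index at a time, the
  -- other index being held fixed.
  rw [h1, Finset.sum_comm, Finset.sum_congr rfl fun j _ ↦ sum_eq_of_isTensorialAt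
    (Ψ := fun X Y ↦ g.inner x (curvature g X (W j) (W j) x) (Y x))
    (fun Y hY ↦ (isTensorialAt_curvature_left (hW j) (hW j) x).metric g _)
    (fun X hX ↦ isTensorialAt_metric_left g x _) hW hes hWo he (by simp) hcard, Finset.sum_comm]
  exact Finset.sum_congr rfl fun i _ ↦ sum_eq_of_isTensorialAt
    (Ψ := fun X Y ↦ g.inner x (curvature g (e i) X Y x) (e i x))
    (fun Y hY ↦ (isTensorialAt_curvature_middle (hes i) hY x).metric g _)
    (fun X hX ↦ (isTensorialAt_curvature_right (hes i) hX x).metric g _) hW hes hWo he (by simp)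
    hcard

end Curvature

/-! ### Lifts along a map and the Koszul formula -/

section Lift

variable {E : Type*} [NormedAddCommGroup E] [NormedSpace ℝ E] [FiniteDimensional ℝ E]
  {M : Type*} [TopologicalSpace M] [T2Space M] [ChartedSpace E M] [IsManifold 𝓘(ℝ, E) ∞ M]
  {F : Type*} [NormedAddCommGroup F] [NormedSpace ℝ F] [FiniteDimensional ℝ F]
  {N : Type*} [TopologicalSpace N] [T2Space N] [ChartedSpace F N] [IsManifold 𝓘(ℝ, F) ∞ N]
  {g : SmoothMetric E M} {g' : SmoothMetric F N} {f : M → N}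
  {X Y Z : Π x : M, TangentSpace 𝓘(ℝ, E) x} {X' Y' Z' : Π y : N, TangentSpace 𝓘(ℝ, F) y}

variable (E F) in
/-- `s` is a smooth vector field along the map `f`. -/
def IsSmoothFieldAlong (f : M → N) (s : Π x : M, TangentSpace 𝓘(ℝ, F) (f x)) : Prop :=
  ContMDiff 𝓘(ℝ, E) 𝓘(ℝ, F).tangent ∞ (fun x ↦ TotalSpace.mk' F (f x) (s x))

theorem IsSmoothField.comp (hX' : IsSmoothField X') (hf : ContMDiff 𝓘(ℝ, E) 𝓘(ℝ, F) ∞ f) :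
    IsSmoothFieldAlong E F f (fun x ↦ X' (f x)) :=
  ContMDiff.comp (g := fun y ↦ TotalSpace.mk' F y (X' y)) hX' hf

theorem IsSmoothField.mfderiv (hX : IsSmoothField X) (hf : ContMDiff 𝓘(ℝ, E) 𝓘(ℝ, F) ∞ f) :
    IsSmoothFieldAlong E F f (fun x ↦ mfderiv 𝓘(ℝ, E) 𝓘(ℝ, F) f x (X x)) :=
  (hf.contMDiff_tangentMap (m := ∞) (by simp)).comp hX

theorem IsSmoothFieldAlong.contMDiff_metric (g' : SmoothMetric F N)
    {s t : Π x : M, TangentSpace 𝓘(ℝ, F) (f x)} (hs : IsSmoothFieldAlong E F f s)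
    (ht : IsSmoothFieldAlong E F f t) :
    ContMDiff 𝓘(ℝ, E) 𝓘(ℝ, ℝ) ∞ (fun x ↦ g'.inner (f x) (s x) (t x)) := by
  let _ : RiemannianBundle (fun x : N ↦ TangentSpace 𝓘(ℝ, F) x) := ⟨g'.toRiemannianMetric⟩
  exact ContMDiff.inner_bundle (F := F) (E := fun x : N ↦ TangentSpace 𝓘(ℝ, F) x) hs ht

/-- The image of a field along `f` under the adjoint of the differential of `f`. -/
noncomputable def adjointField (g : SmoothMetric E M) (g' : SmoothMetric F N) (f : M → N)
    (s : Π x : M, TangentSpace 𝓘(ℝ, F) (f x)) (x : M) : TangentSpace 𝓘(ℝ, E) x :=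
  ∑ i, g'.inner (f x) (s x) (mfderiv 𝓘(ℝ, E) 𝓘(ℝ, F) f x (orthonormalFrame g x i)) •
    orthonormalFrame g x i

theorem metric_adjointField (s : Π x : M, TangentSpace 𝓘(ℝ, F) (f x)) (x : M)
    (u : TangentSpace 𝓘(ℝ, E) x) :
    g.inner x (adjointField g g' f s x) u =
      g'.inner (f x) (s x) (mfderiv 𝓘(ℝ, E) 𝓘(ℝ, F) f x u) := by
  conv_rhs => rw [← sum_metric_smul_eq (orthonormalFrame_orthonormal g x) (by simp) u]
  simp only [adjointField, map_sum, map_smul, sum_apply, smul_apply, smul_eq_mul]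
  exact Finset.sum_congr rfl fun i _ ↦ by rw [g.symm x u, mul_comm]

theorem IsSmoothFieldAlong.adjointField {s : Π x : M, TangentSpace 𝓘(ℝ, F) (f x)}
    (hs : IsSmoothFieldAlong E F f s) (hf : ContMDiff 𝓘(ℝ, E) 𝓘(ℝ, F) ∞ f) :
    IsSmoothField (adjointField g g' f s) :=
  isSmoothField_of_metric_apply g fun W hW ↦ by
    simp only [metric_adjointField]
    exact hs.contMDiff_metric g' (hW.mfderiv hf)

/-- `X` is a lift of `X'`: it is related to `X'` and it is the image of `X'` under the adjoint of
the differential of `f`. For a Riemannian submersion these are the horizontal lifts, for an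
isometric immersion the restrictions of fields which are tangent to the submanifold. -/
structure IsLift (g : SmoothMetric E M) (g' : SmoothMetric F N) (f : M → N)
    (X : Π x : M, TangentSpace 𝓘(ℝ, E) x) (X' : Π y : N, TangentSpace 𝓘(ℝ, F) y) : Prop where
  smooth : IsSmoothField X
  smooth' : IsSmoothField X'
  related : ∀ x, mfderiv 𝓘(ℝ, E) 𝓘(ℝ, F) f x (X x) = X' (f x)
  adjoint : ∀ x (u : TangentSpace 𝓘(ℝ, E) x),
    g.inner x (X x) u = g'.inner (f x) (X' (f x)) (mfderiv 𝓘(ℝ, E) 𝓘(ℝ, F) f x u)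

theorem IsLift.sub (hX : IsLift g g' f X X') (hY : IsLift g g' f Y Y') :
    IsLift g g' f (X - Y) (X' - Y') where
  smooth := hX.smooth.sub hY.smooth
  smooth' := hX.smooth'.sub hY.smooth'
  related x := by
    rw [Pi.sub_apply, map_sub, hX.related, hY.related]
    rfl
  adjoint x u := by
    simp only [Pi.sub_apply, map_sub, sub_apply, hX.adjoint, hY.adjoint]

theorem IsLift.metric_eq (hX : IsLift g g' f X X') (hY : IsLift g g' f Y Y') (x : M) :
    g.inner x (X x) (Y x) = g'.inner (f x) (X' (f x)) (Y' (f x)) := by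
  rw [hX.adjoint, hY.related]

theorem mvfderiv_comp_apply_of_contMDiff {h : N → ℝ} (hh : ContMDiff 𝓘(ℝ, F) 𝓘(ℝ, ℝ) ∞ h)
    (hf : ContMDiff 𝓘(ℝ, E) 𝓘(ℝ, F) ∞ f) (x : M) (v : TangentSpace 𝓘(ℝ, E) x) :
    mvfderiv 𝓘(ℝ, E) (fun y ↦ h (f y)) x v =
      mvfderiv 𝓘(ℝ, F) h (f x) (mfderiv 𝓘(ℝ, E) 𝓘(ℝ, F) f x v) :=
  mvfderiv_comp_apply (I := 𝓘(ℝ, F)) (I' := 𝓘(ℝ, E)) x ((hh _).mdifferentiableAt (by simp))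
    ((hf x).mdifferentiableAt (by simp)) v

theorem IsLift.mvfderiv_metric (hX : IsLift g g' f X X') (hY : IsLift g g' f Y Y')
    (hf : ContMDiff 𝓘(ℝ, E) 𝓘(ℝ, F) ∞ f) (x : M) (v : TangentSpace 𝓘(ℝ, E) x) :
    mvfderiv 𝓘(ℝ, E) (fun y ↦ g.inner y (X y) (Y y)) x v =
      mvfderiv 𝓘(ℝ, F) (fun y ↦ g'.inner y (X' y) (Y' y)) (f x)
        (mfderiv 𝓘(ℝ, E) 𝓘(ℝ, F) f x v) := by
  simp only [hX.metric_eq hY]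
  exact mvfderiv_comp_apply_of_contMDiff (contMDiff_metric_apply g' hX.smooth' hY.smooth') hf x v

theorem IsLift.mfderiv_mlieBracket (hX : IsLift g g' f X X') (hY : IsLift g g' f Y Y')
    (hf : ContMDiff 𝓘(ℝ, E) 𝓘(ℝ, F) ∞ f) (x : M) :
    mfderiv 𝓘(ℝ, E) 𝓘(ℝ, F) f x (mlieBracket 𝓘(ℝ, E) X Y x) =
      mlieBracket 𝓘(ℝ, F) X' Y' (f x) :=
  mfderiv_mlieBracket_of_related hf hX.smooth hY.smooth hX.smooth' hY.smooth' hX.related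
    hY.related x

/-- The bracket need not be a lift; only its pairing with a lift is controlled, since the adjoint
property of `Z` sees just the image of the bracket. -/
theorem IsLift.metric_mlieBracket (hX : IsLift g g' f X X') (hY : IsLift g g' f Y Y')
    (hZ : IsLift g g' f Z Z') (hf : ContMDiff 𝓘(ℝ, E) 𝓘(ℝ, F) ∞ f) (x : M) :
    g.inner x (mlieBracket 𝓘(ℝ, E) X Y x) (Z x) =
      g'.inner (f x) (mlieBracket 𝓘(ℝ, F) X' Y' (f x)) (Z' (f x)) := by
  rw [g.symm, hZ.adjoint, hX.mfderiv_mlieBracket hY hf, g'.symm]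

theorem IsLift.koszul_eq (hX : IsLift g g' f X X') (hY : IsLift g g' f Y Y')
    (hZ : IsLift g g' f Z Z') (hf : ContMDiff 𝓘(ℝ, E) 𝓘(ℝ, F) ∞ f) (x : M) :
    koszul g X Y Z x = koszul g' X' Y' Z' (f x) := by
  simp only [koszul, hX.mvfderiv_metric hY hf, hX.mvfderiv_metric hZ hf, hY.mvfderiv_metric hZ hf,
    hX.metric_mlieBracket hY hZ hf, hX.metric_mlieBracket hZ hY hf, hY.metric_mlieBracket hZ hX hf,
    hX.related, hY.related, hZ.related]

theorem IsLift.metric_leviCivita (hX : IsLift g g' f X X') (hY : IsLift g g' f Y Y')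
    (hZ : IsLift g g' f Z Z') (hf : ContMDiff 𝓘(ℝ, E) 𝓘(ℝ, F) ∞ f) (x : M) :
    g.inner x (leviCivita g X Y x) (Z x) =
      g'.inner (f x) (leviCivita g' X' Y' (f x)) (Z' (f x)) := by
  rw [hX.smooth.metric_leviCivita hY.smooth hZ.smooth, hX.koszul_eq hY hZ hf,
    hX.smooth'.metric_leviCivita hY.smooth' hZ.smooth']

end Lift

/-! ### Riemannian submersions: horizontal lifts and vertical fields -/

section Submersion

variable {E₁ : Type*} [NormedAddCommGroup E₁] [NormedSpace ℝ E₁] [FiniteDimensional ℝ E₁]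
  {M₁ : Type*} [TopologicalSpace M₁] [T2Space M₁] [ChartedSpace E₁ M₁]
  [IsManifold 𝓘(ℝ, E₁) ∞ M₁]
  {E₂ : Type*} [NormedAddCommGroup E₂] [NormedSpace ℝ E₂] [FiniteDimensional ℝ E₂]
  {M₂ : Type*} [TopologicalSpace M₂] [T2Space M₂] [ChartedSpace E₂ M₂]
  [IsManifold 𝓘(ℝ, E₂) ∞ M₂]
  {g₁ : SmoothMetric E₁ M₁} {g₂ : SmoothMetric E₂ M₂} {φ : M₁ → M₂}
  {X Y U V W : Π x : M₁, TangentSpace 𝓘(ℝ, E₁) x} {X' Y' Z' : Π y : M₂, TangentSpace 𝓘(ℝ, E₂) y}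

/-- Vectors in the image of `dφ*` are horizontal, so the isometry condition makes the defect `d = dφ
dφ* s - s` orthogonal to the image of `dφ dφ*`. Then `|dφ* d|² = ⟨d, dφ dφ* d⟩ = 0`, so `d` is
orthogonal to the image of `dφ`, which is everything. -/
theorem IsRiemannianSubmersion.mfderiv_adjointField (hφ : IsRiemannianSubmersion g₁ g₂ φ)
    (s : Π x : M₁, TangentSpace 𝓘(ℝ, E₂) (φ x)) (x : M₁) :
    mfderiv 𝓘(ℝ, E₁) 𝓘(ℝ, E₂) φ x (adjointField g₁ g₂ φ s x) = s x := by
  have hhor : ∀ s, IsHorizontalAt E₂ g₁ φ x (adjointField g₁ g₂ φ s x) := fun s u hu ↦ by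
    rw [metric_adjointField, hu, map_zero]
  let P : TangentSpace 𝓘(ℝ, E₁) x →L[ℝ] TangentSpace 𝓘(ℝ, E₂) (φ x) :=
    mfderiv 𝓘(ℝ, E₁) 𝓘(ℝ, E₂) φ x
  -- the defect of the claim, as a field along `φ`
  let d : Π y : M₁, TangentSpace 𝓘(ℝ, E₂) (φ y) := fun y ↦
    mfderiv 𝓘(ℝ, E₁) 𝓘(ℝ, E₂) φ y (adjointField g₁ g₂ φ s y) - s y
  have h1 : ∀ t, g₂.inner (φ x) (d x) (P (adjointField g₁ g₂ φ t x)) = 0 := fun t ↦ by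
    have := hφ.isometry x _ _ (hhor s) (hhor t)
    rw [metric_adjointField] at this
    simp only [d, map_sub, sub_apply]
    exact sub_eq_zero.2 this
  have h2 : adjointField g₁ g₂ φ d x = 0 := by
    by_contra hne
    have := g₁.pos x _ hne
    rw [metric_adjointField] at this
    exact this.ne' (h1 d)
  have h3 : d x = 0 := by
    refine metric_ext g₂ fun u ↦ ?_
    obtain ⟨v, rfl⟩ := hφ.maximal_rank x u
    rw [← metric_adjointField (g := g₁) d x v, h2]
    simp
  exact sub_eq_zero.1 h3

theorem IsRiemannianSubmersion.isLift_adjointField (hφ : IsRiemannianSubmersion g₁ g₂ φ)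
    (hX' : IsSmoothField X') :
    IsLift g₁ g₂ φ (adjointField g₁ g₂ φ fun x ↦ X' (φ x)) X' where
  smooth := (hX'.comp hφ.smooth).adjointField hφ.smooth
  smooth' := hX'
  related := hφ.mfderiv_adjointField _
  adjoint := metric_adjointField _

/-- Any smooth extension `W` of `v` becomes vertical after subtracting its horizontal part `dφ* dφ
W`, which vanishes at `x`. -/
theorem IsRiemannianSubmersion.exists_isVertical (hφ : IsRiemannianSubmersion g₁ g₂ φ) {x : M₁}
    {v : TangentSpace 𝓘(ℝ, E₁) x} (hv : mfderiv 𝓘(ℝ, E₁) 𝓘(ℝ, E₂) φ x v = 0) :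
    ∃ V : Π x : M₁, TangentSpace 𝓘(ℝ, E₁) x, IsSmoothField V ∧ IsVertical E₁ E₂ φ V ∧ V x = v := by
  obtain ⟨W, hW, rfl⟩ := exists_isSmoothField_apply_eq x v
  let H := adjointField g₁ g₂ φ fun x ↦ mfderiv 𝓘(ℝ, E₁) 𝓘(ℝ, E₂) φ x (W x)
  refine ⟨W - H, hW.sub ((hW.mfderiv hφ.smooth).adjointField hφ.smooth), fun y ↦ ?_, ?_⟩
  · rw [Pi.sub_apply, map_sub, hφ.mfderiv_adjointField]
    exact sub_self _
  · have : H x = 0 := metric_ext g₁ fun u ↦ by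
      rw [metric_adjointField, hv]
      simp
    rw [Pi.sub_apply, this, sub_zero]

/-- Each tangent vector is the value of a horizontal lift plus that of a vertical field, so these
two kinds of test fields suffice. -/
theorem IsRiemannianSubmersion.metric_ext (hφ : IsRiemannianSubmersion g₁ g₂ φ) {x : M₁}
    {v w : TangentSpace 𝓘(ℝ, E₁) x}
    (hV : ∀ V, IsSmoothField V → IsVertical E₁ E₂ φ V → g₁.inner x v (V x) = g₁.inner x w (V x))
    (hX : ∀ X X', IsLift g₁ g₂ φ X X' → g₁.inner x v (X x) = g₁.inner x w (X x)) : v = w := by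
  refine AlmostYamabe.metric_ext g₁ fun u ↦ ?_
  obtain ⟨X', hX', hX'u⟩ := exists_isSmoothField_apply_eq (φ x)
    (mfderiv 𝓘(ℝ, E₁) 𝓘(ℝ, E₂) φ x u)
  have hL := hφ.isLift_adjointField hX'
  obtain ⟨V, hVs, hVv, hVx⟩ := hφ.exists_isVertical (x := x)
    (v := u - adjointField g₁ g₂ φ (fun x ↦ X' (φ x)) x) (by
      rw [map_sub, hL.related, hX'u]
      exact sub_self _)
  have h1 := hV V hVs hVv
  have h2 := hX _ _ hL
  rw [hVx, map_sub, map_sub, h2] at h1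
  exact sub_left_injective h1

theorem IsLift.metric_isVertical (hX : IsLift g₁ g₂ φ X X') (hV : IsVertical E₁ E₂ φ V) (x : M₁) :
    g₁.inner x (X x) (V x) = 0 := by
  rw [hX.adjoint, hV, map_zero]

/-- A vertical field is related to zero, so the bracket is related to `[X', 0] = 0`. -/
theorem isVertical_mlieBracket_of_related (hφ : ContMDiff 𝓘(ℝ, E₁) 𝓘(ℝ, E₂) ∞ φ)
    (hX : IsSmoothField X) (hX' : IsSmoothField X')
    (h : ∀ x, mfderiv 𝓘(ℝ, E₁) 𝓘(ℝ, E₂) φ x (X x) = X' (φ x)) (hVs : IsSmoothField V)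
    (hV : IsVertical E₁ E₂ φ V) : IsVertical E₁ E₂ φ (mlieBracket 𝓘(ℝ, E₁) X V) := fun x ↦ by
  rw [mfderiv_mlieBracket_of_related hφ hX hVs hX' isSmoothField_zero h hV x,
    mlieBracket_zero_right]
  rfl

theorem IsLift.isVertical_mlieBracket (hX : IsLift g₁ g₂ φ X X')
    (hφ : ContMDiff 𝓘(ℝ, E₁) 𝓘(ℝ, E₂) ∞ φ) (hVs : IsSmoothField V) (hV : IsVertical E₁ E₂ φ V) :
    IsVertical E₁ E₂ φ (mlieBracket 𝓘(ℝ, E₁) X V) :=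
  isVertical_mlieBracket_of_related hφ hX.smooth hX.smooth' hX.related hVs hV

theorem IsVertical.mlieBracket (hφ : ContMDiff 𝓘(ℝ, E₁) 𝓘(ℝ, E₂) ∞ φ)
    (hUs : IsSmoothField U) (hU : IsVertical E₁ E₂ φ U) (hVs : IsSmoothField V)
    (hV : IsVertical E₁ E₂ φ V) : IsVertical E₁ E₂ φ (mlieBracket 𝓘(ℝ, E₁) U V) :=
  isVertical_mlieBracket_of_related hφ hUs isSmoothField_zero hU hVs hV

theorem IsLift.mvfderiv_metric_isVertical (hX : IsLift g₁ g₂ φ X X') (hY : IsLift g₁ g₂ φ Y Y')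
    (hφ : ContMDiff 𝓘(ℝ, E₁) 𝓘(ℝ, E₂) ∞ φ) (hV : IsVertical E₁ E₂ φ V) (x : M₁) :
    mvfderiv 𝓘(ℝ, E₁) (fun y ↦ g₁.inner y (X y) (Y y)) x (V x) = 0 := by
  rw [hX.mvfderiv_metric hY hφ, hV, map_zero]

/-- All other Koszul terms vanish: lifts are orthogonal to vertical fields, `g(X, Y)` is constant
along the fibres, and `[X, V]`, `[Y, V]` are vertical. -/
theorem IsLift.koszul_isVertical_right (hX : IsLift g₁ g₂ φ X X') (hY : IsLift g₁ g₂ φ Y Y')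
    (hφ : ContMDiff 𝓘(ℝ, E₁) 𝓘(ℝ, E₂) ∞ φ) (hVs : IsSmoothField V) (hV : IsVertical E₁ E₂ φ V)
    (x : M₁) :
    koszul g₁ X Y V x = (1 / 2) * g₁.inner x (mlieBracket 𝓘(ℝ, E₁) X Y x) (V x) := by
  simp only [koszul, hX.metric_isVertical hV, hY.metric_isVertical hV,
    hX.mvfderiv_metric_isVertical hY hφ hV, g₁.symm x (mlieBracket 𝓘(ℝ, E₁) X V x),
    g₁.symm x (mlieBracket 𝓘(ℝ, E₁) Y V x),
    hY.metric_isVertical (hX.isVertical_mlieBracket hφ hVs hV),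
    hX.metric_isVertical (hY.isVertical_mlieBracket hφ hVs hV)]
  simp [mvfderiv_const]

theorem IsLift.koszul_isVertical_left (hX : IsLift g₁ g₂ φ X X') (hY : IsLift g₁ g₂ φ Y Y')
    (hφ : ContMDiff 𝓘(ℝ, E₁) 𝓘(ℝ, E₂) ∞ φ) (hVs : IsSmoothField V) (hV : IsVertical E₁ E₂ φ V)
    (x : M₁) :
    koszul g₁ V X Y x = -((1 / 2) * g₁.inner x (mlieBracket 𝓘(ℝ, E₁) X Y x) (V x)) := by
  have h : ∀ {Z Z'}, IsLift g₁ g₂ φ Z Z' → ∀ y, g₁.inner y (V y) (Z y) = 0 := fun hZ y ↦ by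
    rw [g₁.symm, hZ.metric_isVertical hV]
  have h' : ∀ {Z Z' T T'}, IsLift g₁ g₂ φ Z Z' → IsLift g₁ g₂ φ T T' →
      g₁.inner x (mlieBracket 𝓘(ℝ, E₁) V Z x) (T x) = 0 := fun {Z Z' T T'} hZ hT ↦ by
    rw [mlieBracket_swap_apply, g₁.symm, map_neg,
      hT.metric_isVertical (hZ.isVertical_mlieBracket hφ hVs hV), neg_zero]
  simp only [koszul, h hX, h hY, hX.mvfderiv_metric_isVertical hY hφ hV, h' hX hY, h' hY hX]
  simp [mvfderiv_const]

end Submersion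

/-! ### The almost complex structure on fields -/

section AlmostComplex

variable {E : Type*} [NormedAddCommGroup E] [NormedSpace ℝ E]
  {M : Type*} [TopologicalSpace M] [ChartedSpace E M] [IsManifold 𝓘(ℝ, E) ∞ M]
  {g : SmoothMetric E M} {J : Π x : M, TangentSpace 𝓘(ℝ, E) x →L[ℝ] TangentSpace 𝓘(ℝ, E) x}
  {X : Π x : M, TangentSpace 𝓘(ℝ, E) x}

theorem IsAlmostHermitian.isSmoothField [FiniteDimensional ℝ E] (hJ : IsAlmostHermitian g J)
    (hX : IsSmoothField X) : IsSmoothField (fun x ↦ J x (X x)) :=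
  fun x ↦ ContMDiffAt.clm_bundle_apply (hJ.smooth x) (hX x)

theorem IsAlmostHermitian.metric_apply (hJ : IsAlmostHermitian g J) (x : M)
    (v w : TangentSpace 𝓘(ℝ, E) x) : g.inner x (J x v) w = -g.inner x v (J x w) :=
  eq_neg_of_add_eq_zero_left (hJ.compatible x v w)

end AlmostComplex

/-! ### Kaehler submersions: integrability and splitting of the curvature -/

section KaehlerSubmersion

variable {E₁ : Type*} [NormedAddCommGroup E₁] [NormedSpace ℝ E₁] [FiniteDimensional ℝ E₁]
  {M₁ : Type*} [TopologicalSpace M₁] [T2Space M₁] [ChartedSpace E₁ M₁]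
  [IsManifold 𝓘(ℝ, E₁) ∞ M₁]
  {E₂ : Type*} [NormedAddCommGroup E₂] [NormedSpace ℝ E₂] [FiniteDimensional ℝ E₂]
  {M₂ : Type*} [TopologicalSpace M₂] [T2Space M₂] [ChartedSpace E₂ M₂]
  [IsManifold 𝓘(ℝ, E₂) ∞ M₂]
  {g₁ : SmoothMetric E₁ M₁} {g₂ : SmoothMetric E₂ M₂} {φ : M₁ → M₂}
  {J₁ : Π x : M₁, TangentSpace 𝓘(ℝ, E₁) x →L[ℝ] TangentSpace 𝓘(ℝ, E₁) x}
  {J₂ : Π x : M₂, TangentSpace 𝓘(ℝ, E₂) x →L[ℝ] TangentSpace 𝓘(ℝ, E₂) x}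
  {X Y Z U V W : Π x : M₁, TangentSpace 𝓘(ℝ, E₁) x}
  {X' Y' Z' : Π y : M₂, TangentSpace 𝓘(ℝ, E₂) y}

theorem IsKaehlerSubmersion.isVertical (hφ : IsKaehlerSubmersion g₁ J₁ g₂ J₂ φ)
    (hV : IsVertical E₁ E₂ φ V) : IsVertical E₁ E₂ φ (fun x ↦ J₁ x (V x)) := fun x ↦ by
  rw [hφ.almostComplex_map, hV, map_zero]

/-- `dφ` intertwines the almost complex structures, and both are skew, so `dφ*` intertwines them as
well. -/
theorem IsKaehlerSubmersion.isLift (hφ : IsKaehlerSubmersion g₁ J₁ g₂ J₂ φ)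
    (hX : IsLift g₁ g₂ φ X X') :
    IsLift g₁ g₂ φ (fun x ↦ J₁ x (X x)) (fun y ↦ J₂ y (X' y)) where
  smooth := hφ.kaehler_total.isSmoothField hX.smooth
  smooth' := hφ.almostHermitian_base.isSmoothField hX.smooth'
  related x := by rw [hφ.almostComplex_map, hX.related]
  adjoint x u := by
    rw [hφ.kaehler_total.metric_apply, hX.adjoint, hφ.almostComplex_map,
      hφ.almostHermitian_base.metric_apply]

/-- Obtained from `g(∇_V JX, Y) = -g(∇_V X, JY)`, both sides being Koszul expressions in brackets.
-/
theorem IsLift.metric_mlieBracket_complex_left (hX : IsLift g₁ g₂ φ X X')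
    (hY : IsLift g₁ g₂ φ Y Y') (hφ : IsKaehlerSubmersion g₁ J₁ g₂ J₂ φ) (hVs : IsSmoothField V)
    (hV : IsVertical E₁ E₂ φ V) (x : M₁) :
    g₁.inner x (mlieBracket 𝓘(ℝ, E₁) X (fun y ↦ J₁ y (Y y)) x) (V x) =
      -g₁.inner x (mlieBracket 𝓘(ℝ, E₁) (fun y ↦ J₁ y (X y)) Y x) (V x) := by
  have h1 := hX.koszul_isVertical_left (hφ.isLift hY) hφ.smooth hVs hV x
  have h2 := (hφ.isLift hX).koszul_isVertical_left hY hφ.smooth hVs hV x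
  rw [← hVs.metric_leviCivita hX.smooth (hφ.isLift hY).smooth] at h1
  rw [← hVs.metric_leviCivita (hφ.isLift hX).smooth hY.smooth,
    hφ.kaehler_total.parallel V X hVs hX.smooth, hφ.kaehler_total.metric_apply] at h2
  linarith

/-- Obtained from `g(∇_X JY, V) = -g(∇_X Y, JV)`, where `JV` is again vertical. -/
theorem IsLift.metric_mlieBracket_complex_right (hX : IsLift g₁ g₂ φ X X')
    (hY : IsLift g₁ g₂ φ Y Y') (hφ : IsKaehlerSubmersion g₁ J₁ g₂ J₂ φ) (hVs : IsSmoothField V)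
    (hV : IsVertical E₁ E₂ φ V) (x : M₁) :
    g₁.inner x (mlieBracket 𝓘(ℝ, E₁) X (fun y ↦ J₁ y (Y y)) x) (V x) =
      -g₁.inner x (mlieBracket 𝓘(ℝ, E₁) X Y x) (J₁ x (V x)) := by
  have hJV := hφ.kaehler_total.isSmoothField hVs
  have h1 := hX.koszul_isVertical_right (hφ.isLift hY) hφ.smooth hVs hV x
  have h2 := hX.koszul_isVertical_right hY hφ.smooth hJV (hφ.isVertical hV) x
  rw [← hX.smooth.metric_leviCivita (hφ.isLift hY).smooth hVs,
    hφ.kaehler_total.parallel X Y hX.smooth hY.smooth, hφ.kaehler_total.metric_apply] at h1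
  rw [← hX.smooth.metric_leviCivita hY.smooth hJV] at h2
  linarith

/-- The horizontal distribution of a Kaehler submersion is integrable. -/
theorem IsLift.metric_mlieBracket_isVertical (hX : IsLift g₁ g₂ φ X X')
    (hY : IsLift g₁ g₂ φ Y Y') (hφ : IsKaehlerSubmersion g₁ J₁ g₂ J₂ φ) (hVs : IsSmoothField V)
    (hV : IsVertical E₁ E₂ φ V) (x : M₁) :
    g₁.inner x (mlieBracket 𝓘(ℝ, E₁) X Y x) (V x) = 0 := by
  -- Put `A = g([X, Y], JV)`. The right rule for `(X, Y)` and for `(Y, X)` gives `g([X, JY], V) =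
  -- -A` and `g([JX, Y], V) = -A`, while the left rule makes these two opposite; so `A = 0`.
  -- Applying this to `JV` and using `J² = -1` removes the `J`.
  have key : ∀ {V : Π x : M₁, TangentSpace 𝓘(ℝ, E₁) x}, IsSmoothField V → IsVertical E₁ E₂ φ V →
      g₁.inner x (mlieBracket 𝓘(ℝ, E₁) X Y x) (J₁ x (V x)) = 0 := fun {V} hVs hV ↦ by
    have h1 := hX.metric_mlieBracket_complex_left hY hφ hVs hV x
    have h2 := hX.metric_mlieBracket_complex_right hY hφ hVs hV x
    have h3 := hY.metric_mlieBracket_complex_right hX hφ hVs hV x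
    rw [mlieBracket_swap_apply, mlieBracket_swap_apply (V := Y)] at h3
    simp only [map_neg, neg_apply] at h3
    linarith
  have h := key (hφ.kaehler_total.isSmoothField hVs) (hφ.isVertical hV)
  rwa [hφ.kaehler_total.sq, map_neg, neg_eq_zero] at h

/-- The vertical part of `∇_X Y` is half that of `[X, Y]`, hence zero by integrability; the
horizontal part is fixed by the Koszul formula on the base. -/
theorem IsLift.leviCivita (hX : IsLift g₁ g₂ φ X X') (hY : IsLift g₁ g₂ φ Y Y')
    (hφ : IsKaehlerSubmersion g₁ J₁ g₂ J₂ φ) :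
    IsLift g₁ g₂ φ (leviCivita g₁ X Y) (leviCivita g₂ X' Y') := by
  have hL := hφ.isLift_adjointField (hX.smooth'.leviCivita (g := g₂) hY.smooth')
  convert hL using 1
  ext1 x
  refine hφ.metric_ext (fun V hVs hV ↦ ?_) fun Z Z' hZ ↦ ?_
  · rw [hL.metric_isVertical hV, hX.smooth.metric_leviCivita hY.smooth hVs,
      hX.koszul_isVertical_right hY hφ.smooth hVs hV,
      hX.metric_mlieBracket_isVertical hY hφ hVs hV, mul_zero]
  · rw [hL.metric_eq hZ, hX.metric_leviCivita hY hZ hφ.smooth]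

theorem IsLift.mlieBracket (hX : IsLift g₁ g₂ φ X X') (hY : IsLift g₁ g₂ φ Y Y')
    (hφ : IsKaehlerSubmersion g₁ J₁ g₂ J₂ φ) :
    IsLift g₁ g₂ φ (mlieBracket 𝓘(ℝ, E₁) X Y) (mlieBracket 𝓘(ℝ, E₂) X' Y') := by
  rw [← leviCivita_sub_swap (g := g₁) hX.smooth hY.smooth,
    ← leviCivita_sub_swap (g := g₂) hX.smooth' hY.smooth']
  exact (hX.leviCivita hY hφ).sub (hY.leviCivita hX hφ)

theorem IsLift.curvature (hX : IsLift g₁ g₂ φ X X') (hY : IsLift g₁ g₂ φ Y Y')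
    (hZ : IsLift g₁ g₂ φ Z Z') (hφ : IsKaehlerSubmersion g₁ J₁ g₂ J₂ φ) :
    IsLift g₁ g₂ φ (curvature g₁ X Y Z) (curvature g₂ X' Y' Z') :=
  ((hX.leviCivita (hY.leviCivita hZ hφ) hφ).sub (hY.leviCivita (hX.leviCivita hZ hφ) hφ)).sub
    ((hX.mlieBracket hY hφ).leviCivita hZ hφ)

/-- Against vertical `W`, `g(∇_V X, W) = -g(X, ∇_V W) = 0` by total geodesy; against lifts it is
half a bracket pairing, zero by integrability. -/
theorem IsLift.leviCivita_isVertical_left (hX : IsLift g₁ g₂ φ X X')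
    (hφ : IsKaehlerSubmersion g₁ J₁ g₂ J₂ φ) (hg : HasTotallyGeodesicFibres E₂ g₁ φ)
    (hVs : IsSmoothField V) (hV : IsVertical E₁ E₂ φ V) : AlmostYamabe.leviCivita g₁ V X = 0 := by
  ext1 x
  refine hφ.metric_ext (fun W hWs hW ↦ ?_) fun Y Y' hY ↦ ?_
  · have h := AlmostYamabe.mvfderiv_metric (g := g₁) hVs hX.smooth hWs x
    simp only [hX.metric_isVertical hW, hX.metric_isVertical (hg V W hVs hWs hV hW)] at h
    simp only [mvfderiv_const] at h
    simpa using h.symm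
  · rw [hVs.metric_leviCivita hX.smooth hY.smooth, hX.koszul_isVertical_left hY hφ.smooth hVs hV,
      hX.metric_mlieBracket_isVertical hY hφ hVs hV]
    simp

/-- As `∇_V X = 0`, vanishing torsion gives `∇_X V = [X, V]`. -/
theorem IsLift.isVertical_leviCivita (hX : IsLift g₁ g₂ φ X X')
    (hφ : IsKaehlerSubmersion g₁ J₁ g₂ J₂ φ) (hg : HasTotallyGeodesicFibres E₂ g₁ φ)
    (hVs : IsSmoothField V) (hV : IsVertical E₁ E₂ φ V) :
    IsVertical E₁ E₂ φ (AlmostYamabe.leviCivita g₁ X V) := by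
  have h := leviCivita_sub_swap (g := g₁) hX.smooth hVs
  rw [hX.leviCivita_isVertical_left hφ hg hVs hV, sub_zero] at h
  rw [h]
  exact hX.isVertical_mlieBracket hφ.smooth hVs hV

theorem IsVertical.sub (hU : IsVertical E₁ E₂ φ U) (hV : IsVertical E₁ E₂ φ V) :
    IsVertical E₁ E₂ φ (U - V) := fun x ↦ by
  rw [Pi.sub_apply, map_sub, hU, hV, sub_zero]

theorem IsLift.isVertical_curvature (hX : IsLift g₁ g₂ φ X X')
    (hφ : IsKaehlerSubmersion g₁ J₁ g₂ J₂ φ) (hg : HasTotallyGeodesicFibres E₂ g₁ φ)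
    (hUs : IsSmoothField U) (hU : IsVertical E₁ E₂ φ U)
    (hVs : IsSmoothField V) (hV : IsVertical E₁ E₂ φ V) :
    IsVertical E₁ E₂ φ (AlmostYamabe.curvature g₁ X U V) :=
  ((hX.isVertical_leviCivita hφ hg (hUs.leviCivita hVs) (hg _ _ hUs hVs hU hV)).sub
    (hg _ _ hUs (hX.smooth.leviCivita hVs) hU (hX.isVertical_leviCivita hφ hg hVs hV))).sub
    (hg _ _ (hX.smooth.mlieBracket hUs) hVs (hX.isVertical_mlieBracket hφ.smooth hUs hU) hV)

theorem IsLift.curvature_eq_zero (hX : IsLift g₁ g₂ φ X X') (hY : IsLift g₁ g₂ φ Y Y')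
    (hφ : IsKaehlerSubmersion g₁ J₁ g₂ J₂ φ) (hg : HasTotallyGeodesicFibres E₂ g₁ φ)
    (hVs : IsSmoothField V) (hV : IsVertical E₁ E₂ φ V) (x : M₁) :
    AlmostYamabe.curvature g₁ X V Y x = 0 := by
  have h0 : AlmostYamabe.leviCivita g₁ X 0 x = 0 := by
    have := leviCivita_add_right (g := g₁) hX.smooth (isSmoothField_zero (E := E₁) (M := M₁))
      (isSmoothField_zero (E := E₁) (M := M₁))
    rw [add_zero] at this
    exact congrFun (left_eq_add.1 this) x
  rw [AlmostYamabe.curvature, hY.leviCivita_isVertical_left hφ hg hVs hV, h0,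
    (hX.leviCivita hY hφ).leviCivita_isVertical_left hφ hg hVs hV,
    hY.leviCivita_isVertical_left hφ hg (hX.smooth.mlieBracket hVs)
      (hX.isVertical_mlieBracket hφ.smooth hVs hV)]
  simp

end KaehlerSubmersion

/-! ### Injectivity of the differential of an immersion -/

section Immersion

theorem mfderiv_injective_of_isImmersionAt {E : Type*} [NormedAddCommGroup E] [NormedSpace ℝ E]
    {M : Type*} [TopologicalSpace M] [ChartedSpace E M] [IsManifold 𝓘(ℝ, E) ∞ M]
    {F : Type*} [NormedAddCommGroup F] [NormedSpace ℝ F]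
    {N : Type*} [TopologicalSpace N] [ChartedSpace F N] [IsManifold 𝓘(ℝ, F) ∞ N]
    {f : M → N} {x : M} (hf : IsImmersionAt 𝓘(ℝ, E) 𝓘(ℝ, F) ∞ f x) :
    Function.Injective (mfderiv 𝓘(ℝ, E) 𝓘(ℝ, F) f x) := by
  -- Immersions have the local form `u ↦ (u, 0)`; projecting to the first factor gives a smooth
  -- local left inverse, and the chain rule does the rest.
  let r : F → E := fun v ↦ (hf.equiv.symm v).1
  have hr : ContMDiff 𝓘(ℝ, F) 𝓘(ℝ, E) ∞ r :=
    (contDiff_fst.comp hf.equiv.symm.contDiff).contMDiff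
  have hloc : ∀ y ∈ hf.domChart.source, r (hf.codChart (f y)) = hf.domChart y := fun y hy ↦ by
    have hy' : hf.domChart y ∈ (hf.domChart.extend 𝓘(ℝ, E)).target := by
      simpa using hf.domChart.map_source hy
    have h := hf.writtenInCharts hy'
    simp only [Function.comp_apply, mfld_simps] at h
    rw [hf.domChart.left_inv hy] at h
    simp only [r, h, ContinuousLinearEquiv.symm_apply_apply]
  have h1 : MDifferentiableAt 𝓘(ℝ, F) 𝓘(ℝ, F) hf.codChart (f x) :=
    (contMDiffAt_of_mem_maximalAtlas hf.codChart_mem_maximalAtlas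
      hf.mem_codChart_source).mdifferentiableAt (by simp)
  have h2 : MDifferentiableAt 𝓘(ℝ, E) 𝓘(ℝ, E) hf.domChart.symm (r (hf.codChart (f x))) :=
    (contMDiffAt_symm_of_mem_maximalAtlas hf.domChart_mem_maximalAtlas
      (hloc x hf.mem_domChart_source ▸ hf.domChart.map_source hf.mem_domChart_source)).mdifferentiableAt (by simp)
  have h3 := h2.comp (f x) (((hr _).mdifferentiableAt (by simp)).comp _ h1)
  have h4 := mfderiv_comp x h3 (hf.contMDiffAt.mdifferentiableAt (by simp))
  have h5 : ((hf.domChart.symm ∘ r ∘ hf.codChart) ∘ f) =ᶠ[𝓝 x] id :=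
    eventually_of_mem (hf.domChart.open_source.mem_nhds hf.mem_domChart_source) fun y hy ↦
      (congrArg hf.domChart.symm (hloc y hy)).trans (hf.domChart.left_inv hy)
  rw [h5.mfderiv_eq, mfderiv_id] at h4
  refine Function.LeftInverse.injective
    (g := mfderiv 𝓘(ℝ, F) 𝓘(ℝ, E) (hf.domChart.symm ∘ r ∘ hf.codChart) (f x)) fun v ↦ ?_
  exact (congrArg (fun L ↦ L v) h4).symm

end Immersion

/-! ### The induced metric -/

section InducedMetric

variable {E : Type*} [NormedAddCommGroup E] [NormedSpace ℝ E] [FiniteDimensional ℝ E]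
  {M : Type*} [TopologicalSpace M] [T2Space M] [ChartedSpace E M] [IsManifold 𝓘(ℝ, E) ∞ M]

theorem contMDiffAt_clm_of_apply {V : Type*} [NormedAddCommGroup V] [NormedSpace ℝ V]
    {G : M → E →L[ℝ] V} {x : M}
    (h : ∀ u, ContMDiffAt 𝓘(ℝ, E) 𝓘(ℝ, V) ∞ (fun y ↦ G y u) x) :
    ContMDiffAt 𝓘(ℝ, E) 𝓘(ℝ, E →L[ℝ] V) ∞ G x := by
  let b := finBasis ℝ E
  let c : Fin (finrank ℝ E) → E →L[ℝ] ℝ := fun i ↦ LinearMap.toContinuousLinearMap (b.coord i)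
  have h1 : G = fun y ↦ ∑ i, ContinuousLinearMap.smulRightL ℝ E V (c i) (G y (b i)) := by
    ext y u
    conv_lhs => rw [← b.sum_repr u, map_sum]
    simp [c]
  rw [h1]
  exact ContMDiffAt.sum fun i _ ↦
    (ContinuousLinearMap.contMDiff _).contMDiffAt.comp x (h (b i))

/-- The coordinates of `B` in a trivialization are its values on fields with constant components,
which extend to global smooth fields with the same germ. -/
theorem contMDiff_bilin_section
    {B : Π x : M, TangentSpace 𝓘(ℝ, E) x →L[ℝ] TangentSpace 𝓘(ℝ, E) x →L[ℝ] ℝ}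
    (hB : ∀ X Y : Π x : M, TangentSpace 𝓘(ℝ, E) x, IsSmoothField X → IsSmoothField Y →
      ContMDiff 𝓘(ℝ, E) 𝓘(ℝ, ℝ) ∞ (fun x ↦ B x (X x) (Y x))) :
    ContMDiff 𝓘(ℝ, E) (𝓘(ℝ, E).prod 𝓘(ℝ, E →L[ℝ] E →L[ℝ] ℝ)) ∞
      (fun x ↦ TotalSpace.mk' (E →L[ℝ] E →L[ℝ] ℝ)
        (E := fun x : M ↦ TangentSpace 𝓘(ℝ, E) x →L[ℝ] TangentSpace 𝓘(ℝ, E) x →L[ℝ] ℝ) x (B x)) := by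
  intro x
  rw [contMDiffAt_hom_bundle]
  refine ⟨contMDiffAt_id, contMDiffAt_clm_of_apply fun u ↦ contMDiffAt_clm_of_apply fun w ↦ ?_⟩
  let t := trivializationAt E (fun x : M ↦ TangentSpace 𝓘(ℝ, E) x) x
  have hxt : x ∈ t.baseSet := FiberBundle.mem_baseSet_trivializationAt' x
  have hS : ∀ u : E, ∃ X : Π x : M, TangentSpace 𝓘(ℝ, E) x, IsSmoothField X ∧
      X =ᶠ[𝓝 x] fun y ↦ t.symm y u := fun u ↦ by
    refine exists_isSmoothField_eventuallyEq t.open_baseSet hxt ?_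
    rw [t.contMDiffOn_section_baseSet_iff]
    refine (contMDiffOn_const (c := u)).congr fun y hy ↦ ?_
    simp [t.apply_mk_symm hy]
  obtain ⟨X, hX, hXu⟩ := hS u
  obtain ⟨Y, hY, hYw⟩ := hS w
  refine (hB X Y hX hY x).congr_of_eventuallyEq ?_
  filter_upwards [hXu, hYw, t.open_baseSet.mem_nhds hxt] with y h1 h2 hy
  refine (inCoordinates_apply_eq₂ (E₁ := fun x : M ↦ TangentSpace 𝓘(ℝ, E) x)
    (E₂ := fun x : M ↦ TangentSpace 𝓘(ℝ, E) x) (E₃ := Trivial M ℝ) hy hy (by simp)).trans ?_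
  rw [h1, h2]
  simp
  rfl
theorem exists_inducedMetric {F : Type*} [NormedAddCommGroup F] [NormedSpace ℝ F]
    [FiniteDimensional ℝ F] {N : Type*} [TopologicalSpace N] [ChartedSpace F N]
    [IsManifold 𝓘(ℝ, F) ∞ N] [T2Space N] (g' : SmoothMetric F N) {f : M → N}
    (hf : ContMDiff 𝓘(ℝ, E) 𝓘(ℝ, F) ∞ f)
    (hinj : ∀ x, Function.Injective (mfderiv 𝓘(ℝ, E) 𝓘(ℝ, F) f x)) :
    ∃ g : SmoothMetric E M, ∀ x (v w : TangentSpace 𝓘(ℝ, E) x),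
      g.inner x v w = g'.inner (f x) (mfderiv 𝓘(ℝ, E) 𝓘(ℝ, F) f x v)
        (mfderiv 𝓘(ℝ, E) 𝓘(ℝ, F) f x w) := by
  refine ⟨{
    inner := fun x ↦
      let G : F →L[ℝ] F →L[ℝ] ℝ := g'.inner (f x)
      let P : E →L[ℝ] F := mfderiv 𝓘(ℝ, E) 𝓘(ℝ, F) f x
      (G.bilinearComp P P : E →L[ℝ] E →L[ℝ] ℝ)
    symm := fun x v w ↦ g'.symm (f x) _ _
    pos := fun x v hv ↦ g'.pos (f x) _ fun h ↦ hv (hinj x (h.trans (map_zero _).symm))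
    isVonNBounded := fun x ↦ ?_
    contMDiff := contMDiff_bilin_section fun X Y hX hY ↦
      (hX.mfderiv hf).contMDiff_metric g' (hY.mfderiv hf) }, fun x v w ↦ rfl⟩
  -- The unit ball of the induced form is the preimage under `P` of the ambient one, hence lies in
  -- the image of that bounded set under a linear left inverse of `P`.
  let P : E →L[ℝ] F := mfderiv 𝓘(ℝ, E) 𝓘(ℝ, F) f x
  obtain ⟨L, hL⟩ := P.toLinearMap.exists_leftInverse_of_injective
    (LinearMap.ker_eq_bot.2 (hinj x))
  let s : Set F := {v : TangentSpace 𝓘(ℝ, F) (f x) | g'.inner (f x) v v < 1}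
  have hs : Bornology.IsVonNBounded ℝ s := g'.isVonNBounded (f x)
  have h1 : Bornology.IsVonNBounded ℝ (LinearMap.toContinuousLinearMap L '' s) := hs.image _
  have h2 : P ⁻¹' s ⊆ LinearMap.toContinuousLinearMap L '' s :=
    fun v hv ↦ ⟨P v, hv, LinearMap.congr_fun hL v⟩
  exact h1.subset h2

end InducedMetric

/-! ### Geometry of a fibre and the soliton equation on it -/

section Fibre

variable {E : Type*} [NormedAddCommGroup E] [NormedSpace ℝ E] [FiniteDimensional ℝ E]
  {M : Type*} [TopologicalSpace M] [T2Space M] [ChartedSpace E M] [IsManifold 𝓘(ℝ, E) ∞ M]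
  {E₁ : Type*} [NormedAddCommGroup E₁] [NormedSpace ℝ E₁] [FiniteDimensional ℝ E₁]
  {M₁ : Type*} [TopologicalSpace M₁] [T2Space M₁] [ChartedSpace E₁ M₁]
  [IsManifold 𝓘(ℝ, E₁) ∞ M₁]
  {E₂ : Type*} [NormedAddCommGroup E₂] [NormedSpace ℝ E₂] [FiniteDimensional ℝ E₂]
  {M₂ : Type*} [TopologicalSpace M₂] [T2Space M₂] [ChartedSpace E₂ M₂]
  [IsManifold 𝓘(ℝ, E₂) ∞ M₂]
  {g : SmoothMetric E M} {g₁ : SmoothMetric E₁ M₁} {g₂ : SmoothMetric E₂ M₂}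
  {f : M → M₁} {φ : M₁ → M₂}
  {J₁ : Π x : M₁, TangentSpace 𝓘(ℝ, E₁) x →L[ℝ] TangentSpace 𝓘(ℝ, E₁) x}
  {J₂ : Π x : M₂, TangentSpace 𝓘(ℝ, E₂) x →L[ℝ] TangentSpace 𝓘(ℝ, E₂) x}
  {U V W : Π x : M, TangentSpace 𝓘(ℝ, E) x} {U' V' W' : Π x : M₁, TangentSpace 𝓘(ℝ, E₁) x}

variable (E₂) in
/-- `f` is an isometric immersion whose image is everywhere tangent to the kernel of the
differential of `φ` and of the same dimension, for example the inclusion of a fibre of `φ`. -/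
structure IsFibreImmersion (g : SmoothMetric E M) (g₁ : SmoothMetric E₁ M₁) (φ : M₁ → M₂)
    (f : M → M₁) : Prop where
  smooth : ContMDiff 𝓘(ℝ, E) 𝓘(ℝ, E₁) ∞ f
  isometry : ∀ x (v w : TangentSpace 𝓘(ℝ, E) x), g.inner x v w =
    g₁.inner (f x) (mfderiv 𝓘(ℝ, E) 𝓘(ℝ, E₁) f x v) (mfderiv 𝓘(ℝ, E) 𝓘(ℝ, E₁) f x w)
  mfderiv_eq_zero_iff : ∀ x (v : TangentSpace 𝓘(ℝ, E₁) (f x)),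
    mfderiv 𝓘(ℝ, E₁) 𝓘(ℝ, E₂) φ (f x) v = 0 ↔ ∃ u, mfderiv 𝓘(ℝ, E) 𝓘(ℝ, E₁) f x u = v

theorem IsFibreImmersion.isLift (hf : IsFibreImmersion E₂ g g₁ φ f) (hVs : IsSmoothField V')
    (hV : IsVertical E₁ E₂ φ V') : IsLift g g₁ f (adjointField g g₁ f fun x ↦ V' (f x)) V' where
  smooth := (hVs.comp hf.smooth).adjointField hf.smooth
  smooth' := hVs
  related x := by
    obtain ⟨u, hu⟩ := (hf.mfderiv_eq_zero_iff x (V' (f x))).1 (hV (f x))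
    have : adjointField g g₁ f (fun x ↦ V' (f x)) x = u := metric_ext g fun w ↦ by
      rw [metric_adjointField, hf.isometry, hu]
    rw [this, hu]
  adjoint := metric_adjointField _

theorem IsFibreImmersion.exists_isLift (hf : IsFibreImmersion E₂ g g₁ φ f)
    (hφ : IsRiemannianSubmersion g₁ g₂ φ) {x : M} (u : TangentSpace 𝓘(ℝ, E) x) :
    ∃ V V', IsLift g g₁ f V V' ∧ IsVertical E₁ E₂ φ V' ∧ V x = u := by
  obtain ⟨V', hVs, hV, hVx⟩ := hφ.exists_isVertical ((hf.mfderiv_eq_zero_iff x _).2 ⟨u, rfl⟩)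
  refine ⟨_, V', hf.isLift hVs hV, hV, metric_ext g fun w ↦ ?_⟩
  rw [metric_adjointField, hf.isometry, hVx]

/-- Total geodesy makes `∇_U' V'` vertical, so it restricts to a field on the fibre; by the Koszul
formula that field is `∇_U V`. This is the Gauss formula without second fundamental form. -/
theorem IsFibreImmersion.isLift_leviCivita (hf : IsFibreImmersion E₂ g g₁ φ f)
    (hφ : IsRiemannianSubmersion g₁ g₂ φ) (hg : HasTotallyGeodesicFibres E₂ g₁ φ)
    (hU : IsLift g g₁ f U U') (hUv : IsVertical E₁ E₂ φ U') (hV : IsLift g g₁ f V V')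
    (hVv : IsVertical E₁ E₂ φ V') :
    IsLift g g₁ f (leviCivita g U V) (leviCivita g₁ U' V') := by
  have hL := hf.isLift (hU.smooth'.leviCivita (g := g₁) hV.smooth')
    (hg _ _ hU.smooth' hV.smooth' hUv hVv)
  convert hL using 1
  ext1 x
  refine metric_ext g fun u ↦ ?_
  obtain ⟨W, W', hW, -, rfl⟩ := hf.exists_isLift hφ u
  rw [hL.metric_eq hW, hU.metric_leviCivita hV hW hf.smooth]

theorem IsFibreImmersion.isLift_curvature (hf : IsFibreImmersion E₂ g g₁ φ f)
    (hφ : IsRiemannianSubmersion g₁ g₂ φ) (hg : HasTotallyGeodesicFibres E₂ g₁ φ)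
    (hU : IsLift g g₁ f U U') (hUv : IsVertical E₁ E₂ φ U') (hV : IsLift g g₁ f V V')
    (hVv : IsVertical E₁ E₂ φ V') (hW : IsLift g g₁ f W W') (hWv : IsVertical E₁ E₂ φ W') :
    IsLift g g₁ f (curvature g U V W) (curvature g₁ U' V' W') := by
  have h : ∀ {U V : Π x : M, TangentSpace 𝓘(ℝ, E) x} {U' V' : Π x : M₁, TangentSpace 𝓘(ℝ, E₁) x},
      IsLift g g₁ f U U' → IsVertical E₁ E₂ φ U' → IsLift g g₁ f V V' → IsVertical E₁ E₂ φ V' →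
      IsLift g g₁ f (leviCivita g U V) (leviCivita g₁ U' V') :=
    fun hU hUv hV hVv ↦ hf.isLift_leviCivita hφ hg hU hUv hV hVv
  have hb : IsLift g g₁ f (mlieBracket 𝓘(ℝ, E) U V) (mlieBracket 𝓘(ℝ, E₁) U' V') := by
    rw [← leviCivita_sub_swap (g := g) hU.smooth hV.smooth,
      ← leviCivita_sub_swap (g := g₁) hU.smooth' hV.smooth']
    exact (h hU hUv hV hVv).sub (h hV hVv hU hUv)
  exact ((h hU hUv (h hV hVv hW hWv) (hg _ _ hV.smooth' hW.smooth' hVv hWv)).sub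
    (h hV hVv (h hU hUv hW hWv) (hg _ _ hU.smooth' hW.smooth' hUv hWv))).sub
    (h hb (hUv.mlieBracket hφ.smooth hU.smooth' hV.smooth' hVv) hW hWv)

/-- The scalar curvature of the total space of a Kaehler submersion with totally geodesic fibres
is the sum of those of the fibre and of the base. -/
theorem IsFibreImmersion.scalarCurvature_eq (hf : IsFibreImmersion E₂ g g₁ φ f)
    (hφ : IsKaehlerSubmersion g₁ J₁ g₂ J₂ φ) (hg : HasTotallyGeodesicFibres E₂ g₁ φ)
    (hdim : finrank ℝ E + finrank ℝ E₂ = finrank ℝ E₁) (x : M) :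
    scalarCurvature g₁ (f x) = scalarCurvature g x + scalarCurvature g₂ (φ (f x)) := by
  choose V V' hV hVv hVx using fun i ↦
    hf.exists_isLift hφ.toIsRiemannianSubmersion (orthonormalFrame g x i)
  choose X' hXs hXx using fun i ↦ exists_isSmoothField_apply_eq (φ (f x))
    (orthonormalFrame g₂ (φ (f x)) i)
  have hX := fun i ↦ hφ.isLift_adjointField (hXs i)
  let X := fun i ↦ adjointField g₁ g₂ φ fun x ↦ X' i (φ x)
  change ∀ i, IsLift g₁ g₂ φ (X i) (X' i) at hX
  have hVo : ∀ i j, g.inner x (V i x) (V j x) = if i = j then 1 else 0 := fun i j ↦ by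
    rw [hVx, hVx, orthonormalFrame_orthonormal]
  have hXo : ∀ i j, g₂.inner (φ (f x)) (X' i (φ (f x))) (X' j (φ (f x))) =
      if i = j then 1 else 0 := fun i j ↦ by
    rw [hXx, hXx, orthonormalFrame_orthonormal]
  rw [scalarCurvature_eq_sum (fun i ↦ (hV i).smooth) hVo (by simp),
    scalarCurvature_eq_sum hXs hXo (by simp),
    scalarCurvature_eq_sum (e := Sum.elim V' X) (fun i ↦ ?_) (fun i j ↦ ?_) (by simpa using hdim)]
  · have hVV : ∀ i j, g₁.inner (f x) (curvature g₁ (V' i) (V' j) (V' j) (f x)) (V' i (f x)) =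
        g.inner x (curvature g (V i) (V j) (V j) x) (V i x) := fun i j ↦
      ((hf.isLift_curvature hφ.toIsRiemannianSubmersion hg (hV i) (hVv i) (hV j) (hVv j) (hV j)
        (hVv j)).metric_eq (hV i) x).symm
    have hXX : ∀ i j, g₁.inner (f x) (curvature g₁ (X i) (X j) (X j) (f x)) (X i (f x)) =
        g₂.inner (φ (f x)) (curvature g₂ (X' i) (X' j) (X' j) (φ (f x))) (X' i (φ (f x))) :=
      fun i j ↦ ((hX i).curvature (hX j) (hX j) hφ).metric_eq (hX i) (f x)
    -- The mixed blocks vanish: `R(X, V) V` is vertical, hence orthogonal to `X`, and `R(V, X) X =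
    -- -R(X, V) X = 0`.
    have hXV : ∀ i j, g₁.inner (f x) (curvature g₁ (X i) (V' j) (V' j) (f x)) (X i (f x)) = 0 :=
      fun i j ↦ by
        rw [g₁.symm, (hX i).metric_isVertical ((hX i).isVertical_curvature hφ hg (hV j).smooth'
          (hVv j) (hV j).smooth' (hVv j))]
    have hVX : ∀ i j, g₁.inner (f x) (curvature g₁ (V' i) (X j) (X j) (f x)) (V' i (f x)) = 0 :=
      fun i j ↦ by
        rw [curvature_swap (hV i).smooth' (hX j).smooth (hX j).smooth,
          (hX j).curvature_eq_zero (hX j) hφ hg (hV i).smooth' (hVv i)]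
        simp
    simp only [Fintype.sum_sum_type, Sum.elim_inl, Sum.elim_inr, hVV, hXX, hXV, hVX]
    simp
  · rcases i with i | i
    · exact (hV i).smooth'
    · exact (hX i).smooth
  · rcases i with i | i <;> rcases j with j | j <;> simp only [Sum.elim_inl, Sum.elim_inr]
    · rw [← (hV i).metric_eq (hV j), hVo]
      simp
    · rw [g₁.symm, (hX j).metric_isVertical (hVv i)]
      simp
    · rw [(hX i).metric_isVertical (hVv j)]
      simp
    · rw [(hX i).metric_eq (hX j), hXo]
      simp

/-- Compatibility with the metric and vanishing torsion. In this form the dependence on `X` and `Y`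
is visibly pointwise. -/
theorem lieDerivMetric_eq_leviCivita {η X Y : Π x : M, TangentSpace 𝓘(ℝ, E) x} (hη : IsSmoothField η)
    (hX : IsSmoothField X) (hY : IsSmoothField Y) (x : M) :
    lieDerivMetric g η X Y x =
      g.inner x (leviCivita g X η x) (Y x) + g.inner x (X x) (leviCivita g Y η x) := by
  rw [lieDerivMetric, mvfderiv_metric hη hX hY, ← leviCivita_sub_swap (g := g) hη hX,
    ← leviCivita_sub_swap (g := g) hη hY]
  simp only [Pi.sub_apply, map_sub, sub_apply]
  ring

theorem IsFibreImmersion.lieDerivMetric_eq (hf : IsFibreImmersion E₂ g g₁ φ f)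
    (hφ : IsRiemannianSubmersion g₁ g₂ φ) (hg : HasTotallyGeodesicFibres E₂ g₁ φ)
    (hU : IsLift g g₁ f U U') (hUv : IsVertical E₁ E₂ φ U') (hV : IsLift g g₁ f V V')
    (hVv : IsVertical E₁ E₂ φ V') (hW : IsLift g g₁ f W W') (hWv : IsVertical E₁ E₂ φ W') (x : M) :
    lieDerivMetric g U V W x = lieDerivMetric g₁ U' V' W' (f x) := by
  rw [lieDerivMetric_eq_leviCivita hU.smooth hV.smooth hW.smooth,
    lieDerivMetric_eq_leviCivita hU.smooth' hV.smooth' hW.smooth',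
    (hf.isLift_leviCivita hφ hg hV hVv hU hUv).metric_eq hW,
    hV.metric_eq (hf.isLift_leviCivita hφ hg hW hWv hU hUv)]

theorem IsFibreImmersion.isAlmostYamabeSoliton (hf : IsFibreImmersion E₂ g g₁ φ f)
    (hφ : IsKaehlerSubmersion g₁ J₁ g₂ J₂ φ) (hg : HasTotallyGeodesicFibres E₂ g₁ φ)
    (hdim : finrank ℝ E + finrank ℝ E₂ = finrank ℝ E₁)
    {η : Π x : M₁, TangentSpace 𝓘(ℝ, E₁) x} {μ : M₁ → ℝ} (hsol : IsAlmostYamabeSoliton g₁ η μ)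
    (hη : IsVertical E₁ E₂ φ η) {q : M₂} (hq : ∀ x, φ (f x) = q) :
    IsAlmostYamabeSoliton g (adjointField g g₁ f fun x ↦ η (f x))
      (fun x ↦ μ (f x) - scalarCurvature g₂ q) := by
  have hL := hf.isLift hsol.smooth_field hη
  refine ⟨hL.smooth, (hsol.smooth_function.comp hf.smooth).sub contMDiff_const,
    fun X Y hX hY x ↦ ?_⟩
  -- The equation on the total space concerns fields defined there, while `X` and `Y` live on the
  -- fibre only. They are replaced by restrictions of vertical fields with the same values at `x`,
  -- which pointwise dependence permits.
  obtain ⟨V, V', hV, hVv, hVx⟩ := hf.exists_isLift hφ.toIsRiemannianSubmersion (X x)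
  obtain ⟨W, W', hW, hWv, hWx⟩ := hf.exists_isLift hφ.toIsRiemannianSubmersion (Y x)
  have h := hsol.equation V' W' hV.smooth' hW.smooth' (f x)
  rw [← hf.lieDerivMetric_eq hφ.toIsRiemannianSubmersion hg hL hη hV hVv hW hWv,
    lieDerivMetric_eq_leviCivita hL.smooth hV.smooth hW.smooth,
    leviCivita_apply_eq_of_left hV.smooth hX hL.smooth hVx,
    leviCivita_apply_eq_of_left hW.smooth hY hL.smooth hWx, hVx, hWx,
    ← lieDerivMetric_eq_leviCivita hL.smooth hX hY, ← hV.metric_eq hW, hVx, hWx,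
    hf.scalarCurvature_eq hφ hg hdim, hq] at h
  rw [h]
  ring

/-- The tangent space of a fibre of maximal dimension is the kernel of the differential. -/
theorem mfderiv_eq_zero_iff_of_comp_eq_const {q : M₂} (hφ : ContMDiff 𝓘(ℝ, E₁) 𝓘(ℝ, E₂) ∞ φ)
    (hf : ContMDiff 𝓘(ℝ, E) 𝓘(ℝ, E₁) ∞ f) (hq : ∀ x, φ (f x) = q)
    (hdim : finrank ℝ E + finrank ℝ E₂ = finrank ℝ E₁) {x : M}
    (hinj : Function.Injective (mfderiv 𝓘(ℝ, E) 𝓘(ℝ, E₁) f x))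
    (hsurj : Function.Surjective (mfderiv 𝓘(ℝ, E₁) 𝓘(ℝ, E₂) φ (f x)))
    {v : TangentSpace 𝓘(ℝ, E₁) (f x)} :
    mfderiv 𝓘(ℝ, E₁) 𝓘(ℝ, E₂) φ (f x) v = 0 ↔ ∃ u, mfderiv 𝓘(ℝ, E) 𝓘(ℝ, E₁) f x u = v := by
  let P : E →L[ℝ] E₁ := mfderiv 𝓘(ℝ, E) 𝓘(ℝ, E₁) f x
  let Q : E₁ →L[ℝ] E₂ := mfderiv 𝓘(ℝ, E₁) 𝓘(ℝ, E₂) φ (f x)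
  have hcomp : ∀ u, Q (P u) = 0 := fun u ↦ by
    have h := mfderiv_comp x ((hφ (f x)).mdifferentiableAt (by simp))
      ((hf x).mdifferentiableAt (by simp))
    have h0 : φ ∘ f = fun _ ↦ q := funext hq
    rw [h0, mfderiv_const] at h
    exact (congrArg (fun L ↦ L u) h).symm
  have hle : LinearMap.range P.toLinearMap ≤ LinearMap.ker Q.toLinearMap := by
    rintro _ ⟨u, rfl⟩
    exact hcomp u
  have h1 : finrank ℝ (LinearMap.range P.toLinearMap) = finrank ℝ E :=
    LinearMap.finrank_range_of_inj hinj
  have h2 := Q.toLinearMap.finrank_range_add_finrank_ker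
  have h4 : LinearMap.range Q.toLinearMap = ⊤ := LinearMap.range_eq_top.2 hsurj
  rw [h4, finrank_top] at h2
  have h3 := Submodule.eq_of_le_of_finrank_eq hle (by omega)
  exact (SetLike.ext_iff.1 h3 v).symm

end Fibre

end AlmostYamabe

/-! ### The theorem -/

theorem theorem3p1
    -- total space
    {E₁ : Type*} [NormedAddCommGroup E₁] [NormedSpace ℝ E₁] [FiniteDimensional ℝ E₁]
    {M₁ : Type*} [TopologicalSpace M₁] [T2Space M₁] [SecondCountableTopology M₁]
    [ChartedSpace E₁ M₁] [IsManifold 𝓘(ℝ, E₁) ∞ M₁]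
    -- base space
    {E₂ : Type*} [NormedAddCommGroup E₂] [NormedSpace ℝ E₂] [FiniteDimensional ℝ E₂]
    {M₂ : Type*} [TopologicalSpace M₂] [T2Space M₂] [SecondCountableTopology M₂]
    [ChartedSpace E₂ M₂] [IsManifold 𝓘(ℝ, E₂) ∞ M₂]
    (g₁ : AlmostYamabe.SmoothMetric E₁ M₁)
    (J₁ : Π x : M₁, TangentSpace 𝓘(ℝ, E₁) x →L[ℝ] TangentSpace 𝓘(ℝ, E₁) x)
    (g₂ : AlmostYamabe.SmoothMetric E₂ M₂)
    (J₂ : Π x : M₂, TangentSpace 𝓘(ℝ, E₂) x →L[ℝ] TangentSpace 𝓘(ℝ, E₂) x)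
    (φ : M₁ → M₂) (hφ : AlmostYamabe.IsKaehlerSubmersion g₁ J₁ g₂ J₂ φ)
    (η : Π x : M₁, TangentSpace 𝓘(ℝ, E₁) x) (μ : M₁ → ℝ)
    (hsol : AlmostYamabe.IsAlmostYamabeSoliton g₁ η μ)
    (hη : AlmostYamabe.IsVertical E₁ E₂ φ η)
    (hgeod : AlmostYamabe.HasTotallyGeodesicFibres E₂ g₁ φ)
    -- the fibre over `q`, with its structure of embedded submanifold of dimension
    -- `dim M₁ - dim M₂`
    (q : M₂)
    {E : Type*} [NormedAddCommGroup E] [NormedSpace ℝ E] [FiniteDimensional ℝ E]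
    (hdim : Module.finrank ℝ E + Module.finrank ℝ E₂ = Module.finrank ℝ E₁)
    [ChartedSpace E (φ ⁻¹' {q})] [IsManifold 𝓘(ℝ, E) ∞ (φ ⁻¹' {q})]
    (hfib : Manifold.IsSmoothEmbedding 𝓘(ℝ, E) 𝓘(ℝ, E₁) ∞ (Subtype.val : φ ⁻¹' {q} → M₁)) :
    ∃ (gF : AlmostYamabe.SmoothMetric E (φ ⁻¹' {q}))
      (ηF : Π p : φ ⁻¹' {q}, TangentSpace 𝓘(ℝ, E) p),
      -- `gF` is the induced metric
      (∀ (p : φ ⁻¹' {q}) (v w : TangentSpace 𝓘(ℝ, E) p),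
        gF.inner p v w =
          g₁.inner (p : M₁)
            (mfderiv 𝓘(ℝ, E) 𝓘(ℝ, E₁) (Subtype.val : φ ⁻¹' {q} → M₁) p v)
            (mfderiv 𝓘(ℝ, E) 𝓘(ℝ, E₁) (Subtype.val : φ ⁻¹' {q} → M₁) p w)) ∧
      -- `ηF` is the restriction of `η`
      (∀ p : φ ⁻¹' {q},
        mfderiv 𝓘(ℝ, E) 𝓘(ℝ, E₁) (Subtype.val : φ ⁻¹' {q} → M₁) p (ηF p) = η p) ∧
      AlmostYamabe.IsAlmostYamabeSoliton gF ηF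
        (fun p ↦ μ p - AlmostYamabe.scalarCurvature g₂ q) := by
  have hsmooth : ContMDiff 𝓘(ℝ, E) 𝓘(ℝ, E₁) ∞ (Subtype.val : φ ⁻¹' {q} → M₁) := hfib.contMDiff
  have hinj : ∀ p, Function.Injective
      (mfderiv 𝓘(ℝ, E) 𝓘(ℝ, E₁) (Subtype.val : φ ⁻¹' {q} → M₁) p) := fun p ↦
    AlmostYamabe.mfderiv_injective_of_isImmersionAt (hfib.isImmersion.isImmersionAt p)
  obtain ⟨gF, hgF⟩ := AlmostYamabe.exists_inducedMetric g₁ hsmooth hinj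
  have hq : ∀ p : φ ⁻¹' {q}, φ p = q := fun p ↦ p.2
  have hF : AlmostYamabe.IsFibreImmersion E₂ gF g₁ φ (Subtype.val : φ ⁻¹' {q} → M₁) :=
    ⟨hsmooth, hgF, fun p v ↦
      AlmostYamabe.mfderiv_eq_zero_iff_of_comp_eq_const hφ.smooth hsmooth hq hdim (hinj p)
        (hφ.maximal_rank p)⟩
  -- The adjoint of the inclusion's differential is orthogonal projection to the fibre; as `η` is
  -- vertical, projecting it yields its restriction.
  exact ⟨gF, AlmostYamabe.adjointField gF g₁ Subtype.val fun p : φ ⁻¹' {q} ↦ η p, hgF,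
    (hF.isLift hsol.smooth_field hη).related,
    hF.isAlmostYamabeSoliton hφ hgeod hdim hsol hη hq⟩
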